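/- Let $[n]=\{0,\dots,n-1\}$. A correlation with $n$ experiments and $m$ outcomes is a real tensor $p=\{p(i,j|x,y)\}_{x,y\in[n],\,i,j\in[m]}\in\mathbb{R}^{n^2m^2}$ with $\sum_{i,j\in[m]}p(i,j|x,y)=1$ for all $x,y\in[n]$; it is synchronous if $p(i,j|x,x)=0$ for all $x$ and all $i\neq j$. It is quantum-commuting if there are a unital C*-algebra $\mathfrak{A}$, families of projections $\{E_{x,i}\},\{F_{y,j}\}\subseteq\mathfrak{A}$ with $\sum_{i}E_{x,i}=\sum_jF_{y,j}=1$ and $E_{x,i}F_{y,j}=F_{y,j}E_{x,i}$ for all $x,y\in[n]$, $i,j\in[m]$, and a state $\phi$ on $\mathfrak{A}$ such that $p(i,j|x,y)=\phi(E_{x,i}F_{y,j})$ for all $x,y,i,j$. It is quantum if moreover $\mathfrak{A}$ can be chosen finite-dimensional, and quantum-approximate if it lies in the closure in $\mathbb{R}^{n^2m^2}$ of the set of quantum correlations. Write $C_{qc}^s(n,m)$, $C_q^s(n,m)$ and $C_{qa}^s(n,m)$ for the sets of synchronous quantum-commuting, quantum and quantum-approximate correlations, respectively. **Theorem.** $C_q^s(3,2)=C_{qc}^s(3,2)$.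 Consequently $C_q^s(3,2)$ is a closed subset of $\mathbb{R}^{36}$, and also $C_{qa}^s(3,2)=C_{qc}^s(3,2)$; that is, both the strong and the weak Tsirelson problem have an affirmative answer for synchronous correlations with three experiments and two outcomes. -/

import Mathlib

open scoped ComplexOrder

universe u

namespace QCorr

/-- The real tensors `(p(i,j|x,y))` with `x, y ∈ {0,…,n-1}` and `i, j ∈ {0,…,m-1}`, i.e. `ℝ^(n²m²)`
with its usual (product) topology; `p x y i j` stands for `p(i,j|x,y)`. -/
abbrev Tensor (n m : ℕ) : Type := Fin n → Fin n → Fin m → Fin m → ℝ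

/-- The correlations `C(n,m)`: tensors with `∑_{i,j} p(i,j|x,y) = 1` for all `x, y`. -/
def C (n m : ℕ) : Set (Tensor n m) :=
  {p | ∀ x y, ∑ i, ∑ j, p x y i j = 1}

/-- A state on a unital C*-algebra: a linear functional with `φ(1) = 1` and `φ(a* a) ≥ 0`
(in the order of `ℂ`, so `φ(a* a)` is real and nonnegative). -/
structure IsState {A : Type u} [CStarAlgebra A] (φ : A →ₗ[ℂ] ℂ) : Prop where
  map_one : φ 1 = 1
  nonneg : ∀ a : A, 0 ≤ φ (star a * a)

/-- A projection-valued measure with `m` outcomes: self-adjoint idempotents with sum `1`. -/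
structure IsPVM {A : Type u} [CStarAlgebra A] {m : ℕ} (P : Fin m → A) : Prop where
  proj : ∀ i, IsStarProjection (P i)
  sum_eq_one : ∑ i, P i = 1

/-- `p` arises from the C*-algebra `A`: there are commuting families of projection-valued measures
`E x`, `F y` in `A` and a state `φ` on `A` with `p(i,j|x,y) = φ(E x i * F y j)`. -/
def ArisesFrom {n m : ℕ} (p : Tensor n m) (A : Type u) [CStarAlgebra A] : Prop :=
  ∃ (E F : Fin n → Fin m → A) (φ : A →ₗ[ℂ] ℂ),
    (∀ x, IsPVM (E x)) ∧ (∀ y, IsPVM (F y)) ∧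
    (∀ x i y j, E x i * F y j = F y j * E x i) ∧
    IsState φ ∧
    ∀ x y i j, (p x y i j : ℂ) = φ (E x i * F y j)

/-- The quantum-commuting correlations `C_qc(n,m)`. -/
def Cqc (n m : ℕ) : Set (Tensor n m) :=
  {p | p ∈ C n m ∧ ∃ (A : Type u) (_ : CStarAlgebra A), ArisesFrom p A}

/-- The quantum correlations `C_q(n,m)`: those arising from a finite-dimensional C*-algebra. -/
def Cq (n m : ℕ) : Set (Tensor n m) :=
  {p | p ∈ C n m ∧ ∃ (A : Type u) (_ : CStarAlgebra A), FiniteDimensional ℂ A ∧ ArisesFrom p A}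

/-- The quantum-approximate correlations `C_qa(n,m)`: limits in `ℝ^(n²m²)` of quantum
correlations. -/
def Cqa (n m : ℕ) : Set (Tensor n m) :=
  {p | p ∈ C n m ∧ p ∈ closure (Cq.{u} n m)}

/-- `p` is synchronous: `p(i,j|x,x) = 0` whenever `i ≠ j`. -/
def IsSynchronous {n m : ℕ} (p : Tensor n m) : Prop :=
  ∀ x i j, i ≠ j → p x x i j = 0

/-- The synchronous quantum-commuting correlations `C_qc^s(n,m)`. -/
def CqcSync (n m : ℕ) : Set (Tensor n m) := {p | p ∈ Cqc.{u} n m ∧ IsSynchronous p}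

/-- The synchronous quantum correlations `C_q^s(n,m)`. -/
def CqSync (n m : ℕ) : Set (Tensor n m) := {p | p ∈ Cq.{u} n m ∧ IsSynchronous p}

/-- The synchronous quantum-approximate correlations `C_qa^s(n,m)`. -/
def CqaSync (n m : ℕ) : Set (Tensor n m) := {p | p ∈ Cqa.{u} n m ∧ IsSynchronous p}

end QCorr

/-! Synchronicity makes the projections `E x i` and `F x i` indistinguishable for the state, so the
state is a trace τ on the star algebra generated by the `E x i`
(`IsState.map_mul_comm_of_mem_adjoin`). The correlation is then encoded by the moments a_x = τ(u_x)
and b_xy = τ(u_x u_y) of three reflections, and the question is which moments occur and whether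
finite dimension already gives all of them.

If all inequalities 1 + b₀₁ + b₀₂ + b₁₂ ≥ 0, over all relabellings of outcomes, hold, the moments
are classical (`ofMoments_mem_of_triangle_ge`). Otherwise relabel so that 1 + b₀₁ + b₀₂ + b₁₂ < 0.
Two reflections split into common eigenvectors and 2 × 2 blocks in which both are traceless; hence
the common fixed space of s·u_j and s·u_k has trace at least s(a_j + a_k)/2.
`IsRealTrace.exists_approx_fixed` says this with polynomials in the reflections, so no spectral
projections are needed. Positivity of the square of a combination of the u_x minus multiples of
these three projections yields `IsRealTrace.three_reflections`. Together with the violated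
inequality, this says that subtracting from b three deterministic points of weights |a_j + a_k|/2
leaves a positive semidefinite matrix of constant diagonal (`exists_decomposition`). Such a matrix
is a multiple of a Gram matrix of unit vectors in ℝ³, which Pauli matrices and the maximally
entangled state realise with zero means.

All these conditions are weak inequalities and equations (`IsAdmissible`), so the synchronous
quantum set is closed. For the approximate set, the whole of `Cqc` is shown closed by an ultralimit
of states. -/

namespace QCorr

/-! ### Positivity and Cauchy-Schwarz for tracial functionals -/

section Trace

set_option linter.unusedSectionVars false

variable {B : Type*} [Ring B] [StarRing B] [Algebra ℝ B] [StarModule ℝ B]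

/-- A normalised positive tracial real functional on a real star algebra. -/
structure IsRealTrace (ρ : B →ₗ[ℝ] ℝ) : Prop where
  map_one : ρ 1 = 1
  nonneg : ∀ a, 0 ≤ ρ (star a * a)
  comm : ∀ a b, ρ (a * b) = ρ (b * a)
  map_star : ∀ a, ρ (star a) = ρ a

/-- A self-adjoint unitary. -/
structure IsReflection (u : B) : Prop where
  star_eq : star u = u
  mul_self : u * u = 1

variable (B) in
/-- The cone of finite sums of hermitian squares. -/
def sumHermSq : AddSubmonoid B := AddSubmonoid.closure (Set.range fun c : B => star c * c)

theorem star_mul_self_mem (c : B) : star c * c ∈ sumHermSq B :=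
  AddSubmonoid.subset_closure ⟨c, rfl⟩

theorem conj_mem_sumHermSq {x : B} (hx : x ∈ sumHermSq B) (c : B) :
    star c * x * c ∈ sumHermSq B := by
  induction hx using AddSubmonoid.closure_induction with
  | mem x hx =>
    obtain ⟨d, rfl⟩ := hx
    convert star_mul_self_mem (d * c) using 1
    simp [mul_assoc]
  | zero => simp
  | add x y _ _ hx hy => simpa [mul_add, add_mul] using add_mem hx hy

theorem smul_mem_sumHermSq {x : B} (hx : x ∈ sumHermSq B) {t : ℝ} (ht : 0 ≤ t) :
    t • x ∈ sumHermSq B := by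
  have h := conj_mem_sumHermSq hx (algebraMap ℝ B (√t))
  have e : star (algebraMap ℝ B (√t)) = algebraMap ℝ B (√t) := by
    rw [Algebra.algebraMap_eq_smul_one, star_smul, star_one]; simp
  rw [e, Algebra.algebraMap_eq_smul_one] at h
  simpa [smul_smul, Real.mul_self_sqrt ht] using h

variable {ρ : B →ₗ[ℝ] ℝ}

theorem IsRealTrace.nonneg_of_mem (h : IsRealTrace ρ) {x : B} (hx : x ∈ sumHermSq B) :
    0 ≤ ρ x := by
  induction hx using AddSubmonoid.closure_induction with
  | mem x hx =>
    obtain ⟨d, rfl⟩ := hx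
    exact h.nonneg d
  | zero => simp
  | add x y _ _ hx hy => rw [map_add]; exact add_nonneg hx hy

/-- Traciality turns ρ(d* d y) into ρ(d y d*), and conjugation preserves the cone. -/
theorem IsRealTrace.map_mul_nonneg (h : IsRealTrace ρ) {x y : B} (hx : x ∈ sumHermSq B)
    (hy : y ∈ sumHermSq B) : 0 ≤ ρ (x * y) := by
  induction hx using AddSubmonoid.closure_induction with
  | mem x hx =>
    obtain ⟨d, rfl⟩ := hx
    have e := h.nonneg_of_mem (conj_mem_sumHermSq hy (star d))
    rw [star_star] at e
    rwa [mul_assoc, h.comm]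
  | zero => simp
  | add x z _ _ hx hz => rw [add_mul, map_add]; exact add_nonneg hx hz

theorem IsRealTrace.cauchy_schwarz (h : IsRealTrace ρ) (a b : B) :
    ρ (star a * b) ^ 2 ≤ ρ (star a * a) * ρ (star b * b) := by
  have hsym : ρ (star b * a) = ρ (star a * b) := by
    rw [← h.map_star]; simp
  have key : ∀ t : ℝ, 0 ≤ ρ (star b * b) * (t * t) + 2 * ρ (star a * b) * t + ρ (star a * a) := by
    intro t
    have := h.nonneg (a + t • b)
    simp only [star_add, star_smul, star_trivial, add_mul, mul_add, smul_mul_assoc,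
      mul_smul_comm, map_add, map_smul, smul_eq_mul, hsym] at this
    linarith
  have := discrim_le_zero key
  simp only [discrim] at this
  linarith

/-- Cauchy-Schwarz in the form used below. -/
theorem IsRealTrace.abs_le (h : IsRealTrace ρ) {a b : B} {α β : ℝ} (hα : 0 ≤ α) (hβ : 0 ≤ β)
    (ha : ρ (star a * a) ≤ α ^ 2) (hb : ρ (star b * b) ≤ β ^ 2) :
    |ρ (star a * b)| ≤ α * β := by
  apply abs_le_of_sq_le_sq _ (mul_nonneg hα hβ)
  calc _ ≤ _ := h.cauchy_schwarz a b
    _ ≤ α ^ 2 * β ^ 2 := mul_le_mul ha hb (h.nonneg b) (sq_nonneg _)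
    _ = _ := by ring

theorem IsReflection.sq_sub_one {w : B} (hw : IsReflection w) :
    (w - 1) * (w - 1) = (2 : ℝ) • (1 - w) := by
  simp only [sub_mul, mul_sub, hw.mul_self, mul_one, one_mul, two_smul]; abel

theorem IsReflection.half_add_mem {w : B} (hw : IsReflection w) :
    (1 / 2 : ℝ) • (1 + w) ∈ sumHermSq B := by
  have := star_mul_self_mem ((1 / 2 : ℝ) • (1 + w))
  convert this using 1
  simp only [star_smul, star_add, star_one, hw.star_eq, star_trivial, smul_mul_smul_comm, add_mul,
    mul_add, hw.mul_self, mul_one, one_mul]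
  module

theorem IsReflection.smul {w : B} (hw : IsReflection w) {s : ℝ} (hs : s = 1 ∨ s = -1) :
    IsReflection (s • w) := by
  constructor
  · simp [star_smul, hw.star_eq]
  · rcases hs with rfl | rfl <;> simp [hw.mul_self]

/-! ### Two reflections and powers of their mean -/

section Pair

variable {u v q : B}

theorem mean_mul_left (hu : IsReflection u) (hv : IsReflection v)
    (hq : q = (1 / 2 : ℝ) • (u + v)) : q * u = v * q := by
  simp [hq, add_mul, mul_add, hu.mul_self, hv.mul_self, add_comm]

/-- Moving `q` past a reflection swaps `u` and `v`, so moving `q ^ 2` past it changes nothing. -/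
theorem mean_sq_comm (hu : IsReflection u) (hv : IsReflection v)
    (hq : q = (1 / 2 : ℝ) • (u + v)) : Commute (q ^ 2) u := by
  have h1 := mean_mul_left hu hv hq
  have h2 : q * v = u * q := mean_mul_left hv hu (by rw [hq, add_comm])
  rw [Commute, SemiconjBy, pow_two, mul_assoc, h1, ← mul_assoc, h2, mul_assoc]

theorem star_mean (hu : IsReflection u) (hv : IsReflection v)
    (hq : q = (1 / 2 : ℝ) • (u + v)) : star q = q := by
  simp [hq, star_smul, hu.star_eq, hv.star_eq]

theorem star_mean_pow (hu : IsReflection u) (hv : IsReflection v)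
    (hq : q = (1 / 2 : ℝ) • (u + v)) (n : ℕ) : star (q ^ n) = q ^ n := by
  rw [star_pow, star_mean hu hv hq]

theorem one_sub_mean_sq_mem (hu : IsReflection u) (hv : IsReflection v)
    (hq : q = (1 / 2 : ℝ) • (u + v)) : 1 - q ^ 2 ∈ sumHermSq B := by
  convert star_mul_self_mem ((1 / 2 : ℝ) • (u - v)) using 1
  simp only [hq, star_smul, star_sub, hu.star_eq, hv.star_eq, star_trivial, smul_mul_smul_comm,
    pow_two, add_mul, mul_add, sub_mul, mul_sub, hu.mul_self, hv.mul_self]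
  module

theorem half_one_add_mean_mem (hu : IsReflection u) (hv : IsReflection v)
    (hq : q = (1 / 2 : ℝ) • (u + v)) : (1 / 2 : ℝ) • (1 + q) ∈ sumHermSq B := by
  have := add_mem (smul_mem_sumHermSq hu.half_add_mem (by norm_num : (0 : ℝ) ≤ 1 / 2))
    (smul_mem_sumHermSq hv.half_add_mem (by norm_num : (0 : ℝ) ≤ 1 / 2))
  convert this using 1
  rw [hq]; module

theorem IsReflection.neg {w : B} (hw : IsReflection w) : IsReflection (-w) :=
  ⟨by simp [hw.star_eq], by simp [hw.mul_self]⟩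

theorem half_one_sub_mean_mem (hu : IsReflection u) (hv : IsReflection v)
    (hq : q = (1 / 2 : ℝ) • (u + v)) : (1 / 2 : ℝ) • (1 - q) ∈ sumHermSq B := by
  rw [sub_eq_add_neg]
  apply half_one_add_mean_mem hu.neg hv.neg
  rw [hq]; module

theorem one_sub_mean_pow_mem (hu : IsReflection u) (hv : IsReflection v)
    (hq : q = (1 / 2 : ℝ) • (u + v)) (n : ℕ) : 1 - q ^ (2 * n) ∈ sumHermSq B := by
  induction n with
  | zero => simp
  | succ n ih =>
    have h1 := conj_mem_sumHermSq (one_sub_mean_sq_mem hu hv hq) (q ^ n)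
    rw [star_mean_pow hu hv hq] at h1
    convert add_mem ih h1 using 1
    simp only [mul_sub, sub_mul, mul_one, ← pow_add]
    rw [show n + n = 2 * n by ring, show n + 2 + n = 2 * (n + 1) by ring]
    abel

/-- By `q * u = v * q` and traciality, `u` and `v` have equal trace against a positive power of `q`,
so either may be replaced by their mean `q`. -/
theorem IsRealTrace.mean_pow_mul (h : IsRealTrace ρ) (hu : IsReflection u) (hv : IsReflection v)
    (hq : q = (1 / 2 : ℝ) • (u + v)) (n : ℕ) : ρ (q ^ (n + 1) * u) = ρ (q ^ (n + 2)) := by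
  have h1 : ρ (q ^ (n + 1) * u) = ρ (q ^ (n + 1) * v) := by
    rw [pow_succ, mul_assoc, mean_mul_left hu hv hq, ← mul_assoc, h.comm, ← mul_assoc, ← pow_succ',
      pow_succ]
  have h2 : q ^ (n + 2) = (1 / 2 : ℝ) • (q ^ (n + 1) * u + q ^ (n + 1) * v) := by
    rw [← mul_add, ← mul_smul_comm, ← hq, ← pow_succ]
  rw [h2, map_smul, map_add, ← h1, smul_eq_mul]; ring

/-- On a 2 × 2 block the spectrum of `q` is symmetric, so odd moments see only the eigenvalues ±1.
Algebraically, the cubic words `u * v * u` and `v * u * v` in `q ^ 3` are conjugates of `v` and `u`,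
and `q ^ (2 * n)` commutes with the conjugating reflection. -/
theorem IsRealTrace.mean_pow_odd (h : IsRealTrace ρ) (hu : IsReflection u) (hv : IsReflection v)
    (hq : q = (1 / 2 : ℝ) • (u + v)) (n : ℕ) : ρ (q ^ (2 * n + 1)) = ρ q := by
  induction n with
  | zero => simp
  | succ n ih =>
    rw [← ih]
    have cu : Commute (q ^ (2 * n)) u := by
      rw [pow_mul]; exact (mean_sq_comm hu hv hq).pow_left n
    have cv : Commute (q ^ (2 * n)) v := by
      rw [pow_mul]; exact (mean_sq_comm hv hu (by rw [hq, add_comm])).pow_left n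
    have huvu : ρ (q ^ (2 * n) * (u * v * u)) = ρ (q ^ (2 * n) * v) := by
      rw [← mul_assoc, h.comm, ← mul_assoc, ← mul_assoc, ← cu.eq, mul_assoc (q ^ _) u u,
        hu.mul_self, mul_one]
    have hvuv : ρ (q ^ (2 * n) * (v * u * v)) = ρ (q ^ (2 * n) * u) := by
      rw [← mul_assoc, h.comm, ← mul_assoc, ← mul_assoc, ← cv.eq, mul_assoc (q ^ _) v v,
        hv.mul_self, mul_one]
    have hcube : q ^ 3 = (1 / 8 : ℝ) • ((3 : ℝ) • u + (3 : ℝ) • v + u * v * u + v * u * v) := by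
      simp only [hq, pow_succ, pow_zero, one_mul, smul_mul_smul_comm, add_mul, mul_add, hu.mul_self,
        hv.mul_self, mul_assoc, mul_one]
      module
    rw [show 2 * (n + 1) + 1 = 2 * n + 3 by ring, pow_add, hcube, pow_succ]
    have hlin : q ^ (2 * n) * q = (1 / 2 : ℝ) • (q ^ (2 * n) * u + q ^ (2 * n) * v) := by
      rw [← mul_add, ← mul_smul_comm, ← hq]
    rw [hlin]
    simp only [mul_smul_comm, mul_add, map_smul, map_add, huvu, hvuv, smul_eq_mul]
    ring

/-- Approximations `y` of the projection onto the common fixed space of `u` and `v`. -/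
theorem IsRealTrace.exists_approx_fixed (h : IsRealTrace ρ) (hu : IsReflection u)
    (hv : IsReflection v) {ε : ℝ} (hε : 0 < ε) :
    ∃ y : B, star y = y ∧ y ∈ sumHermSq B ∧ 1 - y ∈ sumHermSq B ∧
      (ρ u + ρ v) / 2 ≤ ρ y ∧
      ρ (star ((u - 1) * y) * ((u - 1) * y)) ≤ ε ^ 2 ∧
      ρ (star ((v - 1) * y) * ((v - 1) * y)) ≤ ε ^ 2 := by
  obtain ⟨q, hq⟩ : ∃ q : B, q = (1 / 2 : ℝ) • (u + v) := ⟨_, rfl⟩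
  have hq' : q = (1 / 2 : ℝ) • (v + u) := by rw [hq, add_comm]
  have hanti : Antitone fun m => ρ (q ^ (2 * m)) := by
    refine antitone_nat_of_succ_le fun m => ?_
    have h1 := h.nonneg_of_mem (conj_mem_sumHermSq (one_sub_mean_sq_mem hu hv hq) (q ^ m))
    rw [star_mean_pow hu hv hq] at h1
    simp only [mul_sub, sub_mul, mul_one, ← pow_add, map_sub] at h1
    rw [show m + m = 2 * m by ring, show m + 2 + m = 2 * (m + 1) by ring] at h1
    linarith
  have hbdd : BddBelow (Set.range fun m => ρ (q ^ (2 * m))) := by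
    refine ⟨0, ?_⟩
    rintro _ ⟨m, rfl⟩
    have := h.nonneg (q ^ m)
    rw [star_mean_pow hu hv hq, ← pow_add] at this
    simpa [two_mul] using this
  have hlim := tendsto_atTop_ciInf hanti hbdd
  have hdiff := hlim.sub (hlim.comp (Filter.tendsto_add_atTop_nat 1))
  rw [sub_self] at hdiff
  have hev : ∀ᶠ m in Filter.atTop, ρ (q ^ (2 * m)) - ρ (q ^ (2 * (m + 1))) < ε ^ 2 :=
    hdiff.eventually_lt_const (by positivity)
  obtain ⟨N, hN⟩ := Filter.eventually_atTop.1 hev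
  -- The error computed below is (ρ(q^(4n)) − ρ(q^(4n+2)))/2, hence the index 2n. Taking n = N + 1
  -- keeps 4n positive, as `mean_pow_mul` requires.
  have hn := hN (2 * (N + 1)) (by lia)
  set n := N + 1 with hndef
  have hcomm : ∀ z : B, Commute q z → q ^ n * z * q ^ n = q ^ (2 * n) * z := by
    intro z hz
    rw [mul_assoc, ← (hz.pow_left n).eq, ← mul_assoc, ← pow_add, two_mul]
  -- Large even powers of `q` isolate the eigenvalues ±1, and the factor (1 + q)/2 removes −1; the
  -- conjugated form exhibits positivity.
  set y := q ^ n * ((1 / 2 : ℝ) • (1 + q)) * q ^ n with hy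
  have hy' : y = (1 / 2 : ℝ) • (q ^ (2 * n) + q ^ (2 * n + 1)) := by
    rw [hy, hcomm _ (((Commute.one_right q).add_right (Commute.refl q)).smul_right _),
      mul_smul_comm, mul_add, mul_one, pow_succ]
  have hstar : star y = y := by
    rw [hy', star_smul, star_add, star_mean_pow hu hv hq, star_mean_pow hu hv hq, star_trivial]
  have herr : ∀ w w' : B, IsReflection w → IsReflection w' → q = (1 / 2 : ℝ) • (w + w') →
      ρ (star ((w - 1) * y) * ((w - 1) * y)) ≤ ε ^ 2 := by
    intro w w' hw hw' hqw
    have e1 : star ((w - 1) * y) * ((w - 1) * y) = y * ((2 : ℝ) • (1 - w)) * y := by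
      rw [← hw.sq_sub_one, star_mul, hstar, star_sub, hw.star_eq, star_one]
      simp only [mul_assoc]
    have e2 : y * y = (1 / 4 : ℝ) • (q ^ (4 * n) + (2 : ℝ) • q ^ (4 * n + 1) + q ^ (4 * n + 2)) := by
      rw [hy']
      simp only [smul_mul_smul_comm, add_mul, mul_add, ← pow_add]
      rw [show 2 * n + 2 * n = 4 * n by ring, show 2 * n + 1 + 2 * n = 4 * n + 1 by ring,
        show 2 * n + (2 * n + 1) = 4 * n + 1 by ring,
        show 2 * n + 1 + (2 * n + 1) = 4 * n + 2 by ring]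
      module
    have e3 : ρ (y * ((2 : ℝ) • (1 - w)) * y) = 2 * (ρ (y * y) - ρ (y * y * w)) := by
      rw [h.comm, ← mul_assoc, mul_smul_comm, mul_sub, mul_one, map_smul, map_sub, smul_eq_mul]
    have m := h.mean_pow_mul hw hw' hqw
    have o := h.mean_pow_odd hu hv hq
    have m0 : ρ (q ^ (4 * n) * w) = ρ (q ^ (4 * n + 1)) := by
      have := m (4 * n - 1)
      rwa [show 4 * n - 1 + 1 = 4 * n by lia, show 4 * n - 1 + 2 = 4 * n + 1 by lia] at this
    have o0 : ρ (q ^ (4 * n + 1)) = ρ q := by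
      have := o (2 * n); rwa [show 2 * (2 * n) = 4 * n by ring] at this
    have o1 : ρ (q ^ (4 * n + 3)) = ρ q := by
      have := o (2 * n + 1); rwa [show 2 * (2 * n + 1) + 1 = 4 * n + 3 by ring] at this
    have m1 : ρ (q ^ (4 * n + 1) * w) = ρ (q ^ (4 * n + 2)) := m (4 * n)
    have m2 : ρ (q ^ (4 * n + 2) * w) = ρ (q ^ (4 * n + 3)) := m (4 * n + 1)
    rw [e1, e3, e2]
    simp only [smul_mul_assoc, add_mul, map_smul, map_add, smul_eq_mul, m0, m1, m2, o0, o1]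
    rw [show 2 * (2 * n) = 4 * n by ring, show 2 * (2 * n + 1) = 4 * n + 2 by ring] at hn
    nlinarith [sq_nonneg ε]
  refine ⟨y, hstar, ?_, ?_, ?_, herr u v hu hv hq, herr v u hv hu hq'⟩
  · have := conj_mem_sumHermSq (half_one_add_mean_mem hu hv hq) (q ^ n)
    rwa [star_mean_pow hu hv hq] at this
  · have h1 := conj_mem_sumHermSq (half_one_sub_mean_mem hu hv hq) (q ^ n)
    rw [star_mean_pow hu hv hq,
      hcomm _ (((Commute.one_right q).sub_right (Commute.refl q)).smul_right _)] at h1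
    convert add_mem (one_sub_mean_pow_mem hu hv hq n) h1 using 1
    rw [hy', pow_succ, mul_smul_comm, mul_sub, mul_one]
    module
  · have h1 := h.nonneg_of_mem (conj_mem_sumHermSq (half_one_sub_mean_mem hu hv hq) (q ^ n))
    rw [star_mean_pow hu hv hq,
      hcomm _ (((Commute.one_right q).sub_right (Commute.refl q)).smul_right _), mul_smul_comm,
      mul_sub, mul_one, ← pow_succ, map_smul, map_sub, smul_eq_mul, h.mean_pow_odd hu hv hq] at h1
    have h2 : ρ q = (ρ u + ρ v) / 2 := by
      rw [hq, map_smul, map_add, smul_eq_mul]; ring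
    rw [hy', map_smul, map_add, h.mean_pow_odd hu hv hq, smul_eq_mul]
    linarith

end Pair

end Trace

theorem le_of_forall_pos_le_add_mul {a b : ℝ} (c : ℝ) (H : ∀ ε > 0, a ≤ b + c * ε) : a ≤ b := by
  have h : Filter.Tendsto (fun ε : ℝ => b + c * ε) (nhdsWithin 0 (Set.Ioi 0)) (nhds (b + c * 0)) :=
    ((continuous_const.add (continuous_const.mul continuous_id)).tendsto 0).mono_left
      nhdsWithin_le_nhds
  simpa using ge_of_tendsto h (Filter.eventually_of_mem self_mem_nhdsWithin H)

/-! ### The quadratic inequality for three reflections -/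

section Trace

variable {B : Type*} [Ring B] [StarRing B] [Algebra ℝ B] [StarModule ℝ B] {ρ : B →ₗ[ℝ] ℝ}

theorem IsRealTrace.le_mul_of_approx (h : IsRealTrace ρ) {w y : B} {ε : ℝ}
    (hε : 0 ≤ ε) (hwy : ρ (star ((w - 1) * y) * ((w - 1) * y)) ≤ ε ^ 2) :
    ρ y - ε ≤ ρ (w * y) := by
  have h1 := h.abs_le (a := 1) (b := (w - 1) * y) zero_le_one hε (by simp [h.map_one]) hwy
  rw [star_one, one_mul, sub_mul, one_mul, map_sub] at h1
  linarith [neg_le_of_abs_le h1]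

theorem IsRealTrace.map_mul_self_le (h : IsRealTrace ρ) {y : B} (hy : y ∈ sumHermSq B)
    (hy' : 1 - y ∈ sumHermSq B) : ρ (y * y) ≤ ρ y := by
  have := h.map_mul_nonneg hy hy'
  rw [mul_sub, mul_one, map_sub] at this
  linarith

theorem IsRealTrace.map_le_one (h : IsRealTrace ρ) {y : B} (hy' : 1 - y ∈ sumHermSq B) :
    ρ y ≤ 1 := by
  have := h.nonneg_of_mem hy'
  rw [map_sub, h.map_one] at this
  linarith

theorem IsRealTrace.neg_le_mul (h : IsRealTrace ρ) {w y : B} (hw : IsReflection w)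
    (hy : y ∈ sumHermSq B) : -ρ y ≤ ρ (w * y) := by
  have := h.map_mul_nonneg hw.half_add_mem hy
  rw [smul_mul_assoc, add_mul, one_mul, map_smul, map_add, smul_eq_mul] at this
  linarith

/-- If `z` is nearly supported in the `1`-eigenspace of `w`, then `ρ (y z)` is nearly bounded by the
trace of `y` compressed to this eigenspace. -/
theorem IsRealTrace.mul_le_of_approx (h : IsRealTrace ρ) {w y z : B} (hw : IsReflection w)
    (hys : star y = y) (hy : y ∈ sumHermSq B) (hy' : 1 - y ∈ sumHermSq B)
    (hzs : star z = z) (hz' : 1 - z ∈ sumHermSq B) {ε : ℝ} (hε : 0 ≤ ε)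
    (hwz : ρ (star ((w - 1) * z) * ((w - 1) * z)) ≤ ε ^ 2) :
    ρ (y * z) ≤ (ρ y + ρ (w * y)) / 2 + ε := by
  -- Replacing ρ(yz) by ρ(p y p z) costs ε/2 for each of the two insertions of the eigenprojection
  -- p; then z ≤ 1 gives ρ(p y p z) ≤ ρ(p y).
  obtain ⟨p, hp⟩ : ∃ p : B, p = (1 / 2 : ℝ) • (1 + w) := ⟨_, rfl⟩
  have hps : star p = p := by simp [hp, star_smul, hw.star_eq]
  have hpp : p * p = p := by
    rw [hp]
    simp only [smul_mul_smul_comm, add_mul, mul_add, hw.mul_self, mul_one, one_mul]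
    module
  have hpw : 1 - p = (-1 / 2 : ℝ) • (w - 1) := by rw [hp]; module
  have hyy : ρ (star y * y) ≤ 1 ^ 2 := by
    rw [hys]; linarith [h.map_mul_self_le hy hy', h.map_le_one hy']
  have hzz : ρ (star ((1 - p) * z) * ((1 - p) * z)) ≤ (ε / 2) ^ 2 := by
    rw [hpw]
    simp only [smul_mul_assoc, star_smul, star_trivial, mul_smul_comm, map_smul, smul_eq_mul]
    nlinarith
  have h1 := h.abs_le zero_le_one (by linarith) hyy hzz
  have hpy : ρ (star (p * y) * (p * y)) ≤ 1 ^ 2 := by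
    have e : star (p * y) * (p * y) = y * (p * y) := by
      rw [star_mul, hys, hps, mul_assoc, ← mul_assoc p p, hpp]
    have h0 := h.nonneg ((1 - p) * y)
    have e' : star ((1 - p) * y) * ((1 - p) * y) = y * y - y * (p * y) := by
      rw [star_mul, hys, star_sub, star_one, hps]
      simp only [mul_sub, sub_mul, one_mul, mul_one, mul_assoc, ← mul_assoc p p, hpp]
      abel
    rw [e', map_sub] at h0
    rw [hys] at hyy
    rw [e]; linarith
  have h3 : ρ (star (p * y) * (z * (1 - p))) = ρ (y * (p * z)) - ρ (p * y * p * z) := by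
    rw [star_mul, hys, hps, mul_sub, mul_one, mul_sub, map_sub, ← mul_assoc (y * p) z p,
      h.comm _ p]
    simp only [mul_assoc]
  have hzz' : ρ (star (z * (1 - p)) * (z * (1 - p))) ≤ (ε / 2) ^ 2 := by
    have : star (z * (1 - p)) * (z * (1 - p)) = ((1 - p) * z) * star ((1 - p) * z) := by
      simp only [star_mul, star_sub, star_one, hps, hzs]
    rw [this, h.comm]; exact hzz
  have h4 := h.abs_le zero_le_one (by linarith) hpy hzz'
  have h5 : 0 ≤ ρ (p * y * p * (1 - z)) := by
    have := conj_mem_sumHermSq hy p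
    rw [hps] at this
    exact h.map_mul_nonneg this hz'
  have h6 : ρ (p * y * p) = ρ (p * y) := by
    rw [h.comm, ← mul_assoc, hpp]
  have h7 : ρ (p * y) = (ρ y + ρ (w * y)) / 2 := by
    rw [hp, smul_mul_assoc, add_mul, one_mul, map_smul, map_add, smul_eq_mul]; ring
  have h8 : ρ (star y * ((1 - p) * z)) = ρ (y * z) - ρ (y * (p * z)) := by
    rw [hys, sub_mul, one_mul, mul_sub, map_sub]
  rw [mul_sub, mul_one, map_sub] at h5
  rw [h3] at h4
  rw [h8] at h1
  linarith [le_of_abs_le h1, le_of_abs_le h4]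

/-- For equal signs this is the compression bound. For opposite signs the left side is at most 0,
and the trace on the right is nonnegative. -/
theorem IsRealTrace.sign_mul_le_of_approx (h : IsRealTrace ρ) {v y z : B} {s s' : ℝ}
    (hs : s = 1 ∨ s = -1) (hs' : s' = 1 ∨ s' = -1) (hv : IsReflection v)
    (hys : star y = y) (hy : y ∈ sumHermSq B) (hy' : 1 - y ∈ sumHermSq B)
    (hzs : star z = z) (hz : z ∈ sumHermSq B) (hz' : 1 - z ∈ sumHermSq B) {ε : ℝ} (hε : 0 ≤ ε)
    (hwz : ρ (star ((s' • v - 1) * z) * ((s' • v - 1) * z)) ≤ ε ^ 2) :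
    s * s' * ρ (y * z) ≤ (ρ y + s * ρ (v * y)) / 2 + ε := by
  by_cases hss : s = s'
  · subst hss
    have := h.mul_le_of_approx (hv.smul hs) hys hy hy' hzs hz' hε hwz
    rw [smul_mul_assoc, map_smul, smul_eq_mul] at this
    have e : s * s = 1 := by rcases hs with rfl | rfl <;> norm_num
    rw [e]; linarith
  · have e : s * s' = -1 := by
      rcases hs with rfl | rfl <;> rcases hs' with rfl | rfl <;> simp_all
    have h1 := h.neg_le_mul (hv.smul hs) hy
    rw [smul_mul_assoc, map_smul, smul_eq_mul] at h1
    have h2 := h.map_mul_nonneg hy hz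
    rw [e]; linarith

/-- The key inequality for three reflections in a tracial algebra. -/
theorem IsRealTrace.three_reflections (h : IsRealTrace ρ) {u₁ u₂ u₃ : B} (h₁ : IsReflection u₁)
    (h₂ : IsReflection u₂) (h₃ : IsReflection u₃) {s₁ s₂ s₃ r₁ r₂ r₃ : ℝ}
    (hs₁ : s₁ = 1 ∨ s₁ = -1) (hs₂ : s₂ = 1 ∨ s₂ = -1) (hs₃ : s₃ = 1 ∨ s₃ = -1)
    (hr₁ : 0 ≤ r₁) (hr₂ : 0 ≤ r₂) (hr₃ : 0 ≤ r₃) :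
    0 ≤ r₃ ^ 2 * (1 + ρ (u₁ * u₂) - s₃ * (ρ u₁ + ρ u₂))
      + r₂ ^ 2 * (1 + ρ (u₁ * u₃) - s₂ * (ρ u₁ + ρ u₃))
      + r₁ ^ 2 * (1 + ρ (u₂ * u₃) - s₁ * (ρ u₂ + ρ u₃))
      + (r₁ * r₂ + r₁ * r₃ + r₂ * r₃)
        * (1 + ρ (u₁ * u₂) + ρ (u₁ * u₃) + ρ (u₂ * u₃)) := by
  have sq : ∀ {s : ℝ}, s = 1 ∨ s = -1 → s * s = 1 := by rintro s (rfl | rfl) <;> norm_num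
  refine le_of_forall_pos_le_add_mul (4 * (r₁ + r₂ + r₃) ^ 2) fun ε hε => ?_
  obtain ⟨y₁, ys₁, yp₁, yo₁, yρ₁, ya₁, yb₁⟩ := h.exists_approx_fixed (h₂.smul hs₁) (h₃.smul hs₁) hε
  obtain ⟨y₂, ys₂, yp₂, yo₂, yρ₂, ya₂, yb₂⟩ := h.exists_approx_fixed (h₁.smul hs₂) (h₃.smul hs₂) hε
  obtain ⟨y₃, ys₃, yp₃, yo₃, yρ₃, ya₃, yb₃⟩ := h.exists_approx_fixed (h₁.smul hs₃) (h₂.smul hs₃) hε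
  -- With t_i the coefficient of u_i, each r_i equals t_j + t_k − t_i; the same substitution
  -- reappears when the matrix in `exists_decomposition` is tested on t.
  have hn := h.nonneg (((r₂ + r₃) / 2) • u₁ + ((r₁ + r₃) / 2) • u₂ + ((r₁ + r₂) / 2) • u₃
    - (s₁ * r₁) • y₁ - (s₂ * r₂) • y₂ - (s₃ * r₃) • y₃)
  simp only [star_sub, star_add, star_smul, star_trivial, h₁.star_eq, h₂.star_eq, h₃.star_eq, ys₁,
    ys₂, ys₃, add_mul, sub_mul, mul_add, mul_sub, smul_mul_smul_comm, map_sub, map_add, map_smul,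
    smul_eq_mul, h₁.mul_self, h₂.mul_self, h₃.mul_self, h.map_one, h.comm u₂ u₁, h.comm u₃ u₁,
    h.comm u₃ u₂, h.comm y₁ u₁, h.comm y₁ u₂, h.comm y₁ u₃, h.comm y₂ u₁, h.comm y₂ u₂,
    h.comm y₂ u₃, h.comm y₃ u₁, h.comm y₃ u₂, h.comm y₃ u₃, h.comm y₂ y₁, h.comm y₃ y₁,
    h.comm y₃ y₂] at hn
  have a₁ := h.le_mul_of_approx hε.le ya₁
  have b₁ := h.le_mul_of_approx hε.le yb₁
  have a₂ := h.le_mul_of_approx hε.le ya₂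
  have b₂ := h.le_mul_of_approx hε.le yb₂
  have a₃ := h.le_mul_of_approx hε.le ya₃
  have b₃ := h.le_mul_of_approx hε.le yb₃
  have z₁₂ := h.sign_mul_le_of_approx hs₁ hs₂ h₁ ys₁ yp₁ yo₁ ys₂ yp₂ yo₂ hε.le ya₂
  have z₁₃ := h.sign_mul_le_of_approx hs₁ hs₃ h₁ ys₁ yp₁ yo₁ ys₃ yp₃ yo₃ hε.le ya₃
  have z₂₁ := h.sign_mul_le_of_approx hs₂ hs₁ h₂ ys₂ yp₂ yo₂ ys₁ yp₁ yo₁ hε.le ya₁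
  have z₂₃ := h.sign_mul_le_of_approx hs₂ hs₃ h₂ ys₂ yp₂ yo₂ ys₃ yp₃ yo₃ hε.le yb₃
  have z₃₁ := h.sign_mul_le_of_approx hs₃ hs₁ h₃ ys₃ yp₃ yo₃ ys₁ yp₁ yo₁ hε.le yb₁
  have z₃₂ := h.sign_mul_le_of_approx hs₃ hs₂ h₃ ys₃ yp₃ yo₃ ys₂ yp₂ yo₂ hε.le yb₂
  have q₁ := h.map_mul_self_le yp₁ yo₁
  have q₂ := h.map_mul_self_le yp₂ yo₂
  have q₃ := h.map_mul_self_le yp₃ yo₃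
  have w₁ := h.neg_le_mul (h₁.smul hs₁) yp₁
  have w₂ := h.neg_le_mul (h₂.smul hs₂) yp₂
  have w₃ := h.neg_le_mul (h₃.smul hs₃) yp₃
  rw [h.comm y₂ y₁] at z₂₁
  rw [h.comm y₃ y₁] at z₃₁
  rw [h.comm y₃ y₂] at z₃₂
  simp only [smul_mul_assoc, map_smul, smul_eq_mul] at a₁ b₁ a₂ b₂ a₃ b₃ w₁ w₂ w₃ yρ₁ yρ₂ yρ₃
  have t₁ := sq hs₁
  have t₂ := sq hs₂
  have t₃ := sq hs₃
  -- The only traces without a direct estimate are ρ(u_i y_i). Half of each is cancelled by the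
  -- bounds on ρ(y_i y_j), the other half by `w₁`, `w₂`, `w₃`. What remains is −2 r_i² ρ(y_i),
  -- bounded by `yρ₁`, `yρ₂`, `yρ₃`.
  linear_combination 2 * hn + 2 * (r₁ + r₃) * r₁ * a₁ + 2 * (r₁ + r₂) * r₁ * b₁
    + 2 * (r₂ + r₃) * r₂ * a₂ + 2 * (r₁ + r₂) * r₂ * b₂
    + 2 * (r₂ + r₃) * r₃ * a₃ + 2 * (r₁ + r₃) * r₃ * b₃
    + 2 * r₁ * r₂ * (z₁₂ + z₂₁) + 2 * r₁ * r₃ * (z₁₃ + z₃₁) + 2 * r₂ * r₃ * (z₂₃ + z₃₂)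
    + r₁ * (r₂ + r₃) * w₁ + r₂ * (r₁ + r₃) * w₂ + r₃ * (r₁ + r₂) * w₃
    + 2 * r₁ ^ 2 * q₁ + 2 * r₂ ^ 2 * q₂ + 2 * r₃ ^ 2 * q₃
    + 2 * r₁ ^ 2 * yρ₁ + 2 * r₂ ^ 2 * yρ₂ + 2 * r₃ ^ 2 * yρ₃
    + 2 * r₁ ^ 2 * ρ (y₁ * y₁) * t₁ + 2 * r₂ ^ 2 * ρ (y₂ * y₂) * t₂
    + 2 * r₃ ^ 2 * ρ (y₃ * y₃) * t₃

end Trace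

/-! ### Moments and the necessary inequalities -/

/-- The values `1, -1` of the two outcomes. -/
def sg : Fin 2 → ℝ := ![1, -1]

@[simp] theorem sg_zero : sg 0 = 1 := rfl

@[simp] theorem sg_one : sg 1 = -1 := rfl

/-- The expectation of the `x`-th observable. -/
def mean (p : Tensor 3 2) (x : Fin 3) : ℝ := ∑ i, ∑ j, sg i * p x x i j

/-- The expectation of the product of the `x`-th and `y`-th observables. -/
def corr (p : Tensor 3 2) (x y : Fin 3) : ℝ := ∑ i, ∑ j, sg i * sg j * p x y i j

/-- The left-hand side of the inequality which, for all `r₁, r₂, r₃ ≥ 0` and all relabellings of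
outcomes, cuts out the synchronous quantum correlations. -/
def defect (r₁ r₂ r₃ a₁ a₂ a₃ b₁₂ b₁₃ b₂₃ : ℝ) : ℝ :=
  r₃ ^ 2 * (1 + b₁₂ - |a₁ + a₂|) + r₂ ^ 2 * (1 + b₁₃ - |a₁ + a₃|)
    + r₁ ^ 2 * (1 + b₂₃ - |a₂ + a₃|)
    + (r₁ * r₂ + r₁ * r₃ + r₂ * r₃) * (1 + b₁₂ + b₁₃ + b₂₃)

/-- A description of the synchronous quantum correlations by weak inequalities. -/
structure IsAdmissible (p : Tensor 3 2) : Prop where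
  sum_eq_one : p ∈ C 3 2
  sync : IsSynchronous p
  nonneg : ∀ x y i j, 0 ≤ p x y i j
  eq : ∀ x y i j,
    p x y i j = (1 + sg i * mean p x + sg j * mean p y + sg i * sg j * corr p x y) / 4
  symm : ∀ x y, corr p x y = corr p y x
  defect_nonneg : ∀ c₁ c₂ c₃ : ℝ, (c₁ = 1 ∨ c₁ = -1) → (c₂ = 1 ∨ c₂ = -1) →
    (c₃ = 1 ∨ c₃ = -1) → ∀ r₁ r₂ r₃ : ℝ, 0 ≤ r₁ → 0 ≤ r₂ → 0 ≤ r₃ →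
    0 ≤ defect r₁ r₂ r₃ (c₁ * mean p 0) (c₂ * mean p 1) (c₃ * mean p 2)
      (c₁ * c₂ * corr p 0 1) (c₁ * c₃ * corr p 0 2) (c₂ * c₃ * corr p 1 2)

theorem exists_sign_mul_eq_abs (a : ℝ) : ∃ s : ℝ, (s = 1 ∨ s = -1) ∧ s * a = |a| := by
  rcases le_total 0 a with h | h
  · exact ⟨1, .inl rfl, by rw [abs_of_nonneg h, one_mul]⟩
  · exact ⟨-1, .inr rfl, by rw [abs_of_nonpos h]; ring⟩

section Trace

variable {B : Type*} [Ring B] [StarRing B] [Algebra ℝ B] [StarModule ℝ B] {ρ : B →ₗ[ℝ] ℝ}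

theorem IsRealTrace.defect_nonneg (h : IsRealTrace ρ) {u₁ u₂ u₃ : B} (h₁ : IsReflection u₁)
    (h₂ : IsReflection u₂) (h₃ : IsReflection u₃) {r₁ r₂ r₃ : ℝ}
    (hr₁ : 0 ≤ r₁) (hr₂ : 0 ≤ r₂) (hr₃ : 0 ≤ r₃) :
    0 ≤ defect r₁ r₂ r₃ (ρ u₁) (ρ u₂) (ρ u₃) (ρ (u₁ * u₂)) (ρ (u₁ * u₃)) (ρ (u₂ * u₃)) := by
  obtain ⟨s₁, hs₁, e₁⟩ := exists_sign_mul_eq_abs (ρ u₂ + ρ u₃)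
  obtain ⟨s₂, hs₂, e₂⟩ := exists_sign_mul_eq_abs (ρ u₁ + ρ u₃)
  obtain ⟨s₃, hs₃, e₃⟩ := exists_sign_mul_eq_abs (ρ u₁ + ρ u₂)
  have := h.three_reflections h₁ h₂ h₃ hs₁ hs₂ hs₃ hr₁ hr₂ hr₃
  rwa [e₁, e₂, e₃] at this

theorem IsRealTrace.isAdmissible (h : IsRealTrace ρ) {e : Fin 3 → Fin 2 → B}
    (hstar : ∀ x i, star (e x i) = e x i) (hidem : ∀ x i, e x i * e x i = e x i)
    (hsum : ∀ x, e x 0 + e x 1 = 1) {p : Tensor 3 2}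
    (hp : ∀ x y i j, p x y i j = ρ (e x i * e y j)) : IsAdmissible p := by
  have h1 : ∀ x, e x 1 = 1 - e x 0 := fun x => by rw [← hsum x]; abel
  have hrefl : ∀ x, IsReflection (e x 0 - e x 1) := by
    intro x
    constructor
    · rw [star_sub, hstar, hstar]
    · rw [h1]
      simp only [mul_sub, sub_mul, hidem, mul_one, one_mul]
      abel
  have hmean : ∀ x, mean p x = ρ (e x 0 - e x 1) := by
    intro x
    simp only [mean, Fin.sum_univ_two, hp, h1, sg_zero, sg_one, mul_sub, sub_mul, mul_one, one_mul,
      map_sub, hidem]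
    ring
  have hcorr : ∀ x y, corr p x y = ρ ((e x 0 - e x 1) * (e y 0 - e y 1)) := by
    intro x y
    simp only [corr, Fin.sum_univ_two, hp, sg_zero, sg_one, mul_sub, sub_mul, map_sub]
    ring
  refine ⟨?_, ?_, ?_, ?_, ?_, ?_⟩
  · intro x y
    simp only [Fin.sum_univ_two, hp, ← map_add, ← mul_add, hsum, mul_one, h.map_one]
  · intro x i j hij
    fin_cases i <;> fin_cases j <;> simp_all [mul_sub, sub_mul]
  · intro x y i j
    have mem : ∀ x i, e x i ∈ sumHermSq B := fun x i => by
      simpa [hstar, hidem] using star_mul_self_mem (e x i)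
    rw [hp]
    exact h.map_mul_nonneg (mem x i) (mem y j)
  · intro x y i j
    rw [hmean, hmean, hcorr, hp, h1, h1]
    fin_cases i <;> fin_cases j <;>
      simp [mul_sub, sub_mul, h1, h.map_one] <;> ring
  · intro x y
    rw [hcorr, hcorr, h.comm]
  · intro c₁ c₂ c₃ hc₁ hc₂ hc₃ r₁ r₂ r₃ hr₁ hr₂ hr₃
    have := h.defect_nonneg ((hrefl 0).smul hc₁) ((hrefl 1).smul hc₂) ((hrefl 2).smul hc₃)
      hr₁ hr₂ hr₃
    simpa only [smul_mul_smul_comm, map_smul, smul_eq_mul, ← hmean, ← hcorr] using this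

end Trace

/-! ### From synchronous states to traces -/

section State

variable {A : Type u} [CStarAlgebra A] {φ : A →ₗ[ℂ] ℂ}

theorem IsState.re_nonneg (h : IsState φ) (a : A) : 0 ≤ (φ (star a * a)).re :=
  (Complex.nonneg_iff.1 (h.nonneg a)).1

theorem IsState.im_eq_zero (h : IsState φ) (a : A) : (φ (star a * a)).im = 0 :=
  (Complex.nonneg_iff.1 (h.nonneg a)).2.symm

theorem IsState.map_star (h : IsState φ) (a : A) : φ (star a) = star (φ a) := by
  have h1 := h.im_eq_zero (a + 1)
  have h2 := h.im_eq_zero (a + Complex.I • 1)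
  have h0 := h.im_eq_zero a
  simp [add_mul, mul_add, h0, h.map_one] at h1 h2
  apply Complex.ext
  · simp; linarith
  · simp; linarith

/-- Positivity at `star a + t • d` is affine in `t`, since the quadratic term vanishes; a nonzero
linear part would violate it for a suitable `t`. -/
theorem IsState.mul_eq_zero (h : IsState φ) {d : A} (hd : φ (star d * d) = 0) (a : A) :
    φ (a * d) = 0 := by
  have key : ∀ t : ℂ, 0 ≤ (φ (a * star a)).re + 2 * (t * φ (a * d)).re := by
    intro t
    have h1 := h.re_nonneg (star a + t • d)
    have h2 : φ (star d * star a) = star (φ (a * d)) := by rw [← h.map_star, star_mul]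
    simp [add_mul, mul_add, hd, h2] at h1
    simp
    linarith
  by_contra hne
  have hpos : 0 < Complex.normSq (φ (a * d)) := Complex.normSq_pos.2 hne
  have := key (((-((φ (a * star a)).re + 1) / Complex.normSq (φ (a * d)) : ℝ) : ℂ)
    * star (φ (a * d)))
  rw [mul_assoc, Complex.star_def, mul_comm (starRingEnd ℂ _), Complex.mul_conj, ← Complex.ofReal_mul,
    Complex.ofReal_re, div_mul_cancel₀ _ hpos.ne'] at this
  have h3 := h.re_nonneg (star a)
  rw [star_star] at h3
  linarith

theorem IsState.mul_eq_zero' (h : IsState φ) {d : A} (hd : φ (star d * d) = 0) (a : A) :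
    φ (star d * a) = 0 := by
  have := h.map_star (star a * d)
  rw [h.mul_eq_zero hd, star_mul, star_star, star_zero] at this
  exact this

/-- A state for which each element of `s` can be exchanged with an element commuting with `s` is
tracial on the star subalgebra generated by `s`. -/
theorem IsState.map_mul_comm_of_mem_adjoin (h : IsState φ) {s : Set A}
    (hs : ∀ e ∈ s, ∃ f, star e = e ∧ star f = f ∧ (∀ e' ∈ s, Commute f e') ∧
      φ (star (e - f) * (e - f)) = 0) {a b : A} (ha : a ∈ StarAlgebra.adjoin ℂ s)
    (hb : b ∈ StarAlgebra.adjoin ℂ s) : φ (a * b) = φ (b * a) := by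
  have hcomm : ∀ f, star f = f → (∀ e' ∈ s, Commute f e') →
      ∀ a ∈ StarAlgebra.adjoin ℂ s, Commute f a := by
    intro f hf hfs a ha
    induction ha using StarAlgebra.adjoin_induction with
    | mem x hx => exact hfs x hx
    | algebraMap r => exact Algebra.commute_algebraMap_right r f
    | add x y _ _ hx hy => exact hx.add_right hy
    | mul x y _ _ hx hy => exact hx.mul_right hy
    | star x _ hx => simpa [hf] using hx.star_star
  induction hb using StarAlgebra.adjoin_induction generalizing a with
  | mem e he =>
    obtain ⟨f, hes, hfs, hf, h0⟩ := hs e he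
    -- The exchange is φ(ae) = φ(af) = φ(fa) = φ(ea).
    have h1 := h.mul_eq_zero h0 a
    have h2 := h.mul_eq_zero' h0 a
    rw [mul_sub, map_sub] at h1
    rw [star_sub, hes, hfs, sub_mul, map_sub, (hcomm f hfs hf a ha).eq] at h2
    linear_combination h1 - h2
  | algebraMap r => rw [Algebra.commutes]
  | add x y _ _ hx hy => rw [mul_add, add_mul, map_add, map_add, hx ha, hy ha]
  | mul x y hx' hy' hx hy =>
    rw [← mul_assoc, hy (mul_mem ha hx'), ← mul_assoc, hx (mul_mem hy' ha), mul_assoc]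
  | star x hx' hx =>
    have := hx (star_mem ha)
    have h1 : star (φ (star a * x)) = φ (star x * a) := by rw [← h.map_star, star_mul, star_star]
    have h2 : star (φ (x * star a)) = φ (a * star x) := by rw [← h.map_star, star_mul, star_star]
    rw [← h1, ← h2, this]

end State

theorem isAdmissible_of_mem_CqcSync {p : Tensor 3 2} (hp : p ∈ CqcSync.{u} 3 2) :
    IsAdmissible p := by
  obtain ⟨⟨-, A, _, E, F, φ, hE, hF, hEF, hφ, hpφ⟩, hsync⟩ := hp
  have hEs := fun x i => ((hE x).proj i).isSelfAdjoint.star_eq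
  have hFs := fun x i => ((hF x).proj i).isSelfAdjoint.star_eq
  have hEi := fun x i => ((hE x).proj i).isIdempotentElem.eq
  have hFi := fun x i => ((hF x).proj i).isIdempotentElem.eq
  -- Synchronicity gives φ(E) = φ(EF) = φ(F), so the expansion E − 2EF + F of the square has value
  -- 0.
  have hnull : ∀ x i, φ (star (E x i - F x i) * (E x i - F x i)) = 0 := by
    intro x i
    have h1 : φ (E x i) = p x x i i := by
      rw [← mul_one (E x i), ← (hF x).sum_eq_one, Finset.mul_sum, map_sum,
        Finset.sum_eq_single i _ (by simp), hpφ]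
      intro j _ hj
      rw [← hpφ, hsync x i j hj.symm, Complex.ofReal_zero]
    have h2 : φ (F x i) = p x x i i := by
      rw [← one_mul (F x i), ← (hE x).sum_eq_one, Finset.sum_mul, map_sum,
        Finset.sum_eq_single i _ (by simp), hpφ]
      intro j _ hj
      rw [← hpφ, hsync x j i hj, Complex.ofReal_zero]
    rw [star_sub, hEs, hFs, mul_sub, sub_mul, sub_mul, hEi, hFi, ← hEF]
    simp only [map_sub, h1, h2, ← hpφ]
    ring
  set s : Set A := Set.range fun z : Fin 3 × Fin 2 => E z.1 z.2 with hs
  have hmem : ∀ x i, E x i ∈ StarAlgebra.adjoin ℂ s := fun x i =>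
    StarAlgebra.subset_adjoin ℂ s ⟨(x, i), rfl⟩
  let S := StarAlgebra.adjoin ℂ s
  let ρ : S →ₗ[ℝ] ℝ :=
    Complex.reLm ∘ₗ φ.restrictScalars ℝ ∘ₗ (S.subtype.toLinearMap.restrictScalars ℝ)
  have hρ : ∀ a : S, ρ a = (φ (a : A)).re := fun _ => rfl
  have htr : IsRealTrace ρ := by
    refine ⟨?_, ?_, ?_, ?_⟩
    · rw [hρ]; simp [hφ.map_one]
    · intro a
      exact hφ.re_nonneg (a : A)
    · intro a b
      rw [hρ, hρ]
      refine congrArg Complex.re (hφ.map_mul_comm_of_mem_adjoin ?_ a.2 b.2)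
      rintro _ ⟨⟨x, i⟩, rfl⟩
      refine ⟨F x i, hEs x i, hFs x i, ?_, hnull x i⟩
      rintro _ ⟨⟨y, j⟩, rfl⟩
      exact (hEF y j x i).symm
    · intro a
      rw [hρ, hρ]
      exact (congrArg Complex.re (hφ.map_star (a : A))).trans (Complex.conj_re _)
  refine htr.isAdmissible (e := fun x i => ⟨E x i, hmem x i⟩) (fun x i => Subtype.ext (hEs x i))
    (fun x i => Subtype.ext (hEi x i)) (fun x => Subtype.ext ?_) (fun x y i j => ?_)
  · simpa [Fin.sum_univ_two] using (hE x).sum_eq_one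
  · have h1 := hφ.mul_eq_zero (hnull y j) (E x i)
    rw [mul_sub, map_sub, sub_eq_zero] at h1
    change _ = (φ (E x i * E y j)).re
    rw [h1, ← hpφ, Complex.ofReal_re]

/-! ### Finite-dimensional models -/

/-- The tensor with expectations `a` and pair expectations `b`. -/
noncomputable def ofMoments (a : Fin 3 → ℝ) (b : Fin 3 → Fin 3 → ℝ) : Tensor 3 2 :=
  fun x y i j => (1 + sg i * a x + sg j * a y + sg i * sg j * b x y) / 4

theorem sg_mul_self (i : Fin 2) : sg i * sg i = 1 := by fin_cases i <;> simp

theorem isPVM_of_reflection {A : Type u} [CStarAlgebra A] {U : A} (hs : star U = U)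
    (hU : U * U = 1) : IsPVM fun i : Fin 2 => (1 / 2 : ℂ) • (1 + (sg i : ℂ) • U) := by
  constructor
  · intro i
    have h : ((sg i : ℂ)) * sg i = 1 := by exact_mod_cast sg_mul_self i
    constructor
    · rw [IsIdempotentElem]
      simp only [smul_mul_smul_comm, add_mul, mul_add, hU, mul_one, one_mul, h]
      module
    · rw [isSelfAdjoint_iff]
      simp [hs]
  · rw [Fin.sum_univ_two, sg_zero, sg_one]
    push_cast
    module

theorem ofMoments_mem_CqSync_of_reflections {A : Type} [CStarAlgebra A] [FiniteDimensional ℂ A]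
    {U V : Fin 3 → A} {φ : A →ₗ[ℂ] ℂ} {a : Fin 3 → ℝ} {b : Fin 3 → Fin 3 → ℝ}
    (hUs : ∀ x, star (U x) = U x) (hU : ∀ x, U x * U x = 1)
    (hVs : ∀ x, star (V x) = V x) (hV : ∀ x, V x * V x = 1)
    (hUV : ∀ x y, U x * V y = V y * U x) (hφ : IsState φ) (hUa : ∀ x, φ (U x) = a x)
    (hVa : ∀ x, φ (V x) = a x) (hb : ∀ x y, φ (U x * V y) = b x y) (hb' : ∀ x, b x x = 1) :
    ofMoments a b ∈ CqSync.{u} 3 2 := by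
  -- Functions on a point transport the concrete algebra from `Type` to the universe `u`.
  refine ⟨⟨?_, PUnit.{u + 1} → A, inferInstance, inferInstance,
    fun x i => (1 / 2 : ℂ) • (1 + (sg i : ℂ) • fun _ => U x),
    fun y j => (1 / 2 : ℂ) • (1 + (sg j : ℂ) • fun _ => V y),
    φ ∘ₗ LinearMap.proj PUnit.unit, ?_, ?_, ?_, ?_, ?_⟩, ?_⟩
  · intro x y
    simp [Fin.sum_univ_two, ofMoments]
    ring
  · exact fun x => isPVM_of_reflection (funext fun _ => hUs x) (funext fun _ => hU x)
  · exact fun x => isPVM_of_reflection (funext fun _ => hVs x) (funext fun _ => hV x)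
  · intro x i y j
    ext
    simp [mul_add, add_mul, smul_smul, hUV]
    module
  · exact ⟨hφ.map_one, fun c => hφ.nonneg (c PUnit.unit)⟩
  · intro x y i j
    simp only [LinearMap.comp_apply, LinearMap.proj_apply, Pi.mul_apply, Pi.one_apply, mul_add, add_mul, map_add, map_smul, smul_eq_mul,
      smul_mul_smul_comm, mul_one, one_mul, hUa, hVa, hb, hφ.map_one, ofMoments]
    push_cast
    ring
  · intro x i j hij
    have := hb' x
    fin_cases i <;> fin_cases j <;> simp_all [ofMoments]

theorem IsPVM.prod {A A' : Type u} [CStarAlgebra A] [CStarAlgebra A'] {m : ℕ} {P : Fin m → A}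
    {P' : Fin m → A'} (h : IsPVM P) (h' : IsPVM P') : IsPVM fun i => (P i, P' i) := by
  refine ⟨fun i => ⟨?_, ?_⟩, ?_⟩
  · exact Prod.ext (h.proj i).isIdempotentElem (h'.proj i).isIdempotentElem
  · exact Prod.ext (h.proj i).isSelfAdjoint (h'.proj i).isSelfAdjoint
  · rw [← prod_mk_sum, h.sum_eq_one, h'.sum_eq_one, Prod.mk_one_one]

/-- A mixture lives on the product of the two algebras, with the weighted sum of the states. -/
theorem convex_CqSync (n m : ℕ) : Convex ℝ (CqSync.{u} n m) := by
  rintro p ⟨⟨hp, A, _, _, E, F, φ, hE, hF, hEF, hφ, hpφ⟩, hps⟩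
    q ⟨⟨hq, A', _, _, E', F', φ', hE', hF', hEF', hφ', hqφ⟩, hqs⟩ s t hs ht hst
  have hst' : (s : ℂ) + t = 1 := by exact_mod_cast hst
  refine ⟨⟨?_, A × A', inferInstance, inferInstance, fun x i => (E x i, E' x i),
    fun y j => (F y j, F' y j),
    (s : ℂ) • (φ ∘ₗ LinearMap.fst ℂ A A') + (t : ℂ) • (φ' ∘ₗ LinearMap.snd ℂ A A'),
    ?_, ?_, ?_, ?_, ?_⟩, ?_⟩
  · intro x y
    simp only [Pi.add_apply, Pi.smul_apply, smul_eq_mul, Finset.sum_add_distrib, ← Finset.mul_sum,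
      hp x y, hq x y, mul_one, hst]
  · exact fun x => (hE x).prod (hE' x)
  · exact fun x => (hF x).prod (hF' x)
  · exact fun x i y j => Prod.ext (hEF x i y j) (hEF' x i y j)
  · refine ⟨?_, fun a => ?_⟩
    · simp [hφ.map_one, hφ'.map_one, hst']
    · exact add_nonneg
        (mul_nonneg (Complex.zero_le_real.2 hs) (hφ.nonneg a.1))
        (mul_nonneg (Complex.zero_le_real.2 ht) (hφ'.nonneg a.2))
  · intro x y i j
    simp [hpφ, hqφ]
  · intro x i j hij
    simp [hps x i j hij, hqs x i j hij]

theorem ofMoments_sign_mem (c : Fin 3 → ℝ) (hc : ∀ x, c x = 1 ∨ c x = -1) :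
    ofMoments c (fun x y => c x * c y) ∈ CqSync.{u} 3 2 := by
  have hcc : ∀ x, c x * c x = 1 := fun x => by rcases hc x with h | h <;> rw [h] <;> norm_num
  refine ofMoments_mem_CqSync_of_reflections (A := ℂ) (U := fun x => (c x : ℂ))
    (V := fun x => (c x : ℂ)) (φ := LinearMap.id) (fun x => Complex.conj_ofReal _)
    (fun x => by exact_mod_cast hcc x) (fun x => Complex.conj_ofReal _)
    (fun x => by exact_mod_cast hcc x) (fun x y => mul_comm _ _) ⟨rfl, fun a => star_mul_self_nonneg a⟩
    (fun x => rfl) (fun x => rfl) (fun x y => by simp) hcc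

section Pauli

open scoped Matrix.Norms.L2Operator Kronecker

/-- The Pauli matrix in the direction `v`. -/
def pauli (v : Fin 3 → ℝ) : Matrix (Fin 2) (Fin 2) ℂ :=
  !![(v 2 : ℂ), v 0 - v 1 * Complex.I; v 0 + v 1 * Complex.I, -(v 2 : ℂ)]

theorem star_pauli (v : Fin 3 → ℝ) : star (pauli v) = pauli v := by
  ext i j
  fin_cases i <;> fin_cases j <;> simp [pauli, Matrix.star_apply]; try ring

theorem pauli_mul_self {v : Fin 3 → ℝ} (hv : v ⬝ᵥ v = 1) : pauli v * pauli v = 1 := by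
  have h : (v 0 : ℂ) * v 0 + v 1 * v 1 + v 2 * v 2 = 1 := by
    rw [← Complex.ofReal_one, ← hv, dotProduct, Fin.sum_univ_three]; push_cast; ring
  have hI := Complex.I_mul_I
  ext i j
  fin_cases i <;> fin_cases j <;> simp [pauli, Matrix.mul_apply, Fin.sum_univ_two]
  · linear_combination h - (v 1 : ℂ) * v 1 * hI
  · ring
  · ring
  · linear_combination h - (v 1 : ℂ) * v 1 * hI

/-- The vector functional of the maximally entangled vector. -/
noncomputable def bell : Matrix (Fin 2 × Fin 2) (Fin 2 × Fin 2) ℂ →ₗ[ℂ] ℂ where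
  toFun M := (1 / 2 : ℂ) * ∑ i, ∑ j, M (i, i) (j, j)
  map_add' M N := by simp [Finset.sum_add_distrib, mul_add]
  map_smul' c M := by simp [← Finset.mul_sum]; ring

theorem bell_kronecker (M N : Matrix (Fin 2) (Fin 2) ℂ) :
    bell (M ⊗ₖ N) = (1 / 2 : ℂ) * ∑ i, ∑ j, M i j * N i j := rfl

theorem isState_bell : IsState bell := by
  constructor
  · norm_num [bell, Fin.sum_univ_two]
  · intro M
    have : bell (star M * M) = (1 / 2 : ℝ) * ∑ k, star (∑ j, M k (j, j)) * (∑ j, M k (j, j)) := by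
      simp [bell, Fin.sum_univ_two, Fintype.sum_prod_type, Matrix.mul_apply, Matrix.star_apply]
      ring
    rw [this]
    exact mul_nonneg (Complex.zero_le_real.2 (by norm_num))
      (Finset.sum_nonneg fun k _ => star_mul_self_nonneg _)

/-- On M ⊗ Nᵀ the functional `bell` is the normalised trace of MN, and for Pauli matrices that trace
is the inner product of the directions; a single Pauli matrix is traceless. -/
theorem ofMoments_gram_mem (v : Fin 3 → Fin 3 → ℝ) (hv : ∀ x, v x ⬝ᵥ v x = 1) :
    ofMoments 0 (fun x y => v x ⬝ᵥ v y) ∈ CqSync.{u} 3 2 := by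
  refine ofMoments_mem_CqSync_of_reflections (A := Matrix (Fin 2 × Fin 2) (Fin 2 × Fin 2) ℂ)
    (U := fun x => pauli (v x) ⊗ₖ 1) (V := fun x => 1 ⊗ₖ (pauli (v x)).transpose) (φ := bell)
    ?_ ?_ ?_ ?_ ?_ isState_bell ?_ ?_ ?_ hv
  · intro x
    rw [Matrix.star_eq_conjTranspose, Matrix.conjTranspose_kronecker,
      ← Matrix.star_eq_conjTranspose, star_pauli, Matrix.conjTranspose_one]
  · intro x
    rw [← Matrix.mul_kronecker_mul, pauli_mul_self (hv x), one_mul, Matrix.one_kronecker_one]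
  · intro x
    have h : (pauli (v x)).transpose.conjTranspose = (star (pauli (v x))).transpose := rfl
    rw [Matrix.star_eq_conjTranspose, Matrix.conjTranspose_kronecker, Matrix.conjTranspose_one, h,
      star_pauli]
  · intro x
    rw [← Matrix.mul_kronecker_mul, ← Matrix.transpose_mul, pauli_mul_self (hv x), one_mul,
      Matrix.transpose_one, Matrix.one_kronecker_one]
  · intro x y
    rw [← Matrix.mul_kronecker_mul, ← Matrix.mul_kronecker_mul]
    simp
  · intro x
    rw [bell_kronecker]
    simp [Fin.sum_univ_two, pauli]
  · intro x
    rw [bell_kronecker]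
    simp [Fin.sum_univ_two, pauli]
  · intro x y
    have hI := Complex.I_mul_I
    rw [← Matrix.mul_kronecker_mul, bell_kronecker, dotProduct, Fin.sum_univ_three]
    simp [Fin.sum_univ_two, pauli]
    linear_combination -(v x 1 : ℂ) * v y 1 * hI

end Pauli

theorem ofMoments_mem_of_sum {ι : Type*} [Fintype ι] (w : ι → ℝ) (a' : ι → Fin 3 → ℝ)
    (b' : ι → Fin 3 → Fin 3 → ℝ) {a : Fin 3 → ℝ} {b : Fin 3 → Fin 3 → ℝ} (hw : ∀ k, 0 ≤ w k)
    (hw1 : ∑ k, w k = 1) (hmem : ∀ k, ofMoments (a' k) (b' k) ∈ CqSync.{u} 3 2)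
    (ha : ∀ x, a x = ∑ k, w k * a' k x) (hb : ∀ x y, b x y = ∑ k, w k * b' k x y) :
    ofMoments a b ∈ CqSync.{u} 3 2 := by
  have h := (convex_CqSync.{u} 3 2).sum_mem (t := Finset.univ) (fun k _ => hw k) hw1
    (fun k _ => hmem k)
  convert h using 1
  ext x y i j
  simp only [Finset.sum_apply, Pi.smul_apply, smul_eq_mul, ofMoments, ha, hb, mul_div_assoc',
    ← Finset.sum_div, mul_add, Finset.sum_add_distrib, mul_one, hw1, Finset.mul_sum]
  congr 2
  · congr 1
    · congr 1
      exact Finset.sum_congr rfl fun k _ => by ring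
    · exact Finset.sum_congr rfl fun k _ => by ring
  · exact Finset.sum_congr rfl fun k _ => by ring

/-! ### Decomposing admissible moments -/

/-- The entry `x` of the sign vector which is `-1` exactly at `k`. -/
def flipSign (k x : Fin 3) : ℝ := if x = k then -1 else 1

theorem flipSign_eq (k x : Fin 3) : flipSign k x = 1 ∨ flipSign k x = -1 := by
  unfold flipSign; split_ifs <;> simp

theorem flipSign_mul_self (k x : Fin 3) : flipSign k x * flipSign k x = 1 := by
  rcases flipSign_eq k x with h | h <;> rw [h] <;> norm_num

/-- A positive semidefinite `3 × 3` matrix with constant diagonal `m` is `m` times the Gram matrix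
of unit vectors. -/
theorem exists_gram {M : Matrix (Fin 3) (Fin 3) ℝ} (hM : M.PosSemidef) {m : ℝ}
    (hm : ∀ x, M x x = m) :
    ∃ v : Fin 3 → Fin 3 → ℝ, (∀ x, v x ⬝ᵥ v x = 1) ∧ ∀ x y, M x y = m * (v x ⬝ᵥ v y) := by
  obtain ⟨R, hR⟩ : ∃ R : Matrix (Fin 3) (Fin 3) ℝ, M = R.conjTranspose * R := by
    open scoped MatrixOrder in
    obtain ⟨R, hR⟩ := CStarAlgebra.nonneg_iff_eq_star_mul_self.1 hM.nonneg
    exact ⟨R, hR⟩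
  have hMR : ∀ x y, M x y = (fun k => R k x) ⬝ᵥ fun k => R k y := fun x y => by
    rw [hR]; simp [Matrix.mul_apply, dotProduct]
  have hm0 : 0 ≤ m := by
    rw [← hm 0, hMR]
    exact Finset.sum_nonneg fun k _ => mul_self_nonneg _
  rcases hm0.eq_or_lt with h0 | hpos
  -- A zero diagonal forces the matrix to vanish, so any unit vectors serve.
  · refine ⟨fun _ => Pi.single 0 1, fun x => by simp, fun x y => ?_⟩
    have hz : (fun k => R k x) = 0 := by
      rw [← dotProduct_self_eq_zero, ← hMR, hm, h0]
    rw [hMR, hz, ← h0, zero_dotProduct, zero_mul]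
  · have hs : √m * √m = m := Real.mul_self_sqrt hm0
    have key : ∀ x y, M x y = m * (((√m)⁻¹ • fun k => R k x) ⬝ᵥ ((√m)⁻¹ • fun k => R k y)) := by
      intro x y
      rw [smul_dotProduct, dotProduct_smul, ← hMR, smul_eq_mul, smul_eq_mul, ← mul_assoc (√m)⁻¹,
        ← mul_inv, hs, ← mul_assoc, mul_inv_cancel₀ hpos.ne', one_mul]
    refine ⟨fun x => (√m)⁻¹ • fun k => R k x, fun x => ?_, key⟩
    have := key x x
    rw [hm] at this
    exact mul_left_cancel₀ hpos.ne' (by rw [← this, mul_one])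

/-- This is where the failing triangle inequality enters: it extends nonnegativity of the form from
the octant r ≥ 0 to all real r. -/
theorem defect_abs_le {r₁ r₂ r₃ a₁ a₂ a₃ b₁₂ b₁₃ b₂₃ : ℝ} (h : 1 + b₁₂ + b₁₃ + b₂₃ ≤ 0) :
    defect |r₁| |r₂| |r₃| a₁ a₂ a₃ b₁₂ b₁₃ b₂₃ ≤ defect r₁ r₂ r₃ a₁ a₂ a₃ b₁₂ b₁₃ b₂₃ := by
  have h1 : r₁ * r₂ + r₁ * r₃ + r₂ * r₃ ≤ |r₁| * |r₂| + |r₁| * |r₃| + |r₂| * |r₃| := by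
    simp only [← abs_mul]
    exact add_le_add (add_le_add (le_abs_self _) (le_abs_self _)) (le_abs_self _)
  have := mul_le_mul_of_nonpos_right h1 h
  simp only [defect, sq_abs]
  linarith

/-- Decomposition of the moments violating one triangle inequality. -/
theorem exists_decomposition {a : Fin 3 → ℝ} {b : Fin 3 → Fin 3 → ℝ} (hb1 : ∀ x, b x x = 1)
    (hbs : ∀ x y, b x y = b y x) (hneg : 1 + b 0 1 + b 0 2 + b 1 2 ≤ 0)
    (hd : ∀ r₁ r₂ r₃ : ℝ, 0 ≤ r₁ → 0 ≤ r₂ → 0 ≤ r₃ →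
      0 ≤ defect r₁ r₂ r₃ (a 0) (a 1) (a 2) (b 0 1) (b 0 2) (b 1 2)) :
    ∃ (m : ℝ) (w s : Fin 3 → ℝ) (v : Fin 3 → Fin 3 → ℝ), 0 ≤ m ∧ (∀ k, 0 ≤ w k) ∧
      m + ∑ k, w k = 1 ∧ (∀ k, s k = 1 ∨ s k = -1) ∧ (∀ x, v x ⬝ᵥ v x = 1) ∧
      (∀ x, a x = ∑ k, w k * (s k * flipSign k x)) ∧
      ∀ x y, b x y = m * (v x ⬝ᵥ v y) + ∑ k, w k * (flipSign k x * flipSign k y) := by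
  obtain ⟨s₀, hs₀, e₀⟩ := exists_sign_mul_eq_abs (a 1 + a 2)
  obtain ⟨s₁, hs₁, e₁⟩ := exists_sign_mul_eq_abs (a 0 + a 2)
  obtain ⟨s₂, hs₂, e₂⟩ := exists_sign_mul_eq_abs (a 0 + a 1)
  have sq : ∀ {s : ℝ}, s = 1 ∨ s = -1 → s * s = 1 := by rintro s (rfl | rfl) <;> norm_num
  -- The sign vectors ±`flipSign k` lie on the face 1 + b₀₁ + b₀₂ + b₁₂ = 0. These weights, with
  -- signs `s₀`, `s₁`, `s₂`, reproduce all the means, so the remainder has mean zero.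
  set w : Fin 3 → ℝ := ![|a 1 + a 2| / 2, |a 0 + a 2| / 2, |a 0 + a 1| / 2] with hw
  have hws : ∀ x, a x = ∑ k, w k * (![s₀, s₁, s₂] k * flipSign k x) := by
    have f₀ : a 1 + a 2 = s₀ * |a 1 + a 2| := by rw [← e₀, ← mul_assoc, sq hs₀, one_mul]
    have f₁ : a 0 + a 2 = s₁ * |a 0 + a 2| := by rw [← e₁, ← mul_assoc, sq hs₁, one_mul]
    have f₂ : a 0 + a 1 = s₂ * |a 0 + a 1| := by rw [← e₂, ← mul_assoc, sq hs₂, one_mul]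
    intro x
    fin_cases x <;> simp [Fin.sum_univ_three, hw, flipSign] <;> linarith
  let M : Matrix (Fin 3) (Fin 3) ℝ := fun x y => b x y - ∑ k, w k * (flipSign k x * flipSign k y)
  have hMdiag : ∀ x, M x x = 1 - ∑ k, w k := fun x => by
    simp only [M, hb1, flipSign_mul_self, mul_one]
  have hM : M.PosSemidef := by
    rw [Matrix.posSemidef_iff_dotProduct_mulVec]
    refine ⟨?_, fun t => ?_⟩
    · ext x y
      rw [Matrix.conjTranspose_apply, star_trivial]
      simp only [M, hbs x y, mul_comm (flipSign _ x)]
    · have h1 := (hd _ _ _ (abs_nonneg (t 1 + t 2 - t 0)) (abs_nonneg (t 0 + t 2 - t 1))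
        (abs_nonneg (t 0 + t 1 - t 2))).trans (defect_abs_le hneg)
      have h2 : 2 * (star t ⬝ᵥ M.mulVec t) = defect (t 1 + t 2 - t 0) (t 0 + t 2 - t 1)
          (t 0 + t 1 - t 2) (a 0) (a 1) (a 2) (b 0 1) (b 0 2) (b 1 2) := by
        simp [dotProduct, Matrix.mulVec, Fin.sum_univ_three, M, hw, flipSign, defect, hb1,
          hbs 1 0, hbs 2 0, hbs 2 1]
        ring
      linarith
  obtain ⟨v, hv1, hv⟩ := exists_gram hM hMdiag
  refine ⟨1 - ∑ k, w k, w, ![s₀, s₁, s₂], v, ?_, ?_, by ring, ?_, hv1, hws, fun x y => ?_⟩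
  · rw [← hMdiag 0]
    exact hM.diag_nonneg
  · intro k
    fin_cases k <;> simp [hw] <;> positivity
  · intro k
    fin_cases k <;> simpa
  · rw [← hv]; simp [M]

theorem ofMoments_mem_of_triangle_le {a c : Fin 3 → ℝ} {b : Fin 3 → Fin 3 → ℝ}
    (hb1 : ∀ x, b x x = 1) (hbs : ∀ x y, b x y = b y x) (hc : ∀ x, c x = 1 ∨ c x = -1)
    (hneg : 1 + c 0 * c 1 * b 0 1 + c 0 * c 2 * b 0 2 + c 1 * c 2 * b 1 2 ≤ 0)
    (hd : ∀ r₁ r₂ r₃ : ℝ, 0 ≤ r₁ → 0 ≤ r₂ → 0 ≤ r₃ →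
      0 ≤ defect r₁ r₂ r₃ (c 0 * a 0) (c 1 * a 1) (c 2 * a 2)
        (c 0 * c 1 * b 0 1) (c 0 * c 2 * b 0 2) (c 1 * c 2 * b 1 2)) :
    ofMoments a b ∈ CqSync.{u} 3 2 := by
  have hcc : ∀ x, c x * c x = 1 := fun x => by rcases hc x with h | h <;> rw [h] <;> norm_num
  obtain ⟨m, w, s, v, hm, hw, hmw, hs, hv, ha, hb⟩ :=
    exists_decomposition (a := fun x => c x * a x) (b := fun x y => c x * c y * b x y)
      (fun x => by simp [hb1, hcc]) (fun x y => by rw [hbs x y, mul_comm (c x)]) hneg hd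
  have hsc : ∀ {p q : ℝ}, (p = 1 ∨ p = -1) → (q = 1 ∨ q = -1) → p * q = 1 ∨ p * q = -1 := by
    rintro p q (rfl | rfl) (rfl | rfl) <;> norm_num
  have hss : ∀ k, s k * s k = 1 := fun k => by rcases hs k with h | h <;> rw [h] <;> norm_num
  refine ofMoments_mem_of_sum (ι := Option (Fin 3)) (fun k => k.elim m w)
    (fun k => k.elim 0 fun k x => c x * (s k * flipSign k x))
    (fun k => k.elim (fun x y => (c x • v x) ⬝ᵥ (c y • v y)) fun k x y =>
      (c x * (s k * flipSign k x)) * (c y * (s k * flipSign k y))) ?_ ?_ ?_ ?_ ?_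
  · rintro (_ | k)
    exacts [hm, hw k]
  · rw [Fintype.sum_option]; exact hmw
  · rintro (_ | k)
    · refine ofMoments_gram_mem _ fun x => ?_
      rw [smul_dotProduct, dotProduct_smul, hv, smul_eq_mul, smul_eq_mul, mul_one, hcc]
    · exact ofMoments_sign_mem _ fun x => hsc (hc x) (hsc (hs k) (flipSign_eq k x))
  · intro x
    have h1 : a x = c x * (c x * a x) := by rw [← mul_assoc, hcc, one_mul]
    rw [h1, ha, Fintype.sum_option, Finset.mul_sum]
    simp only [Option.elim_none, Option.elim_some, Pi.zero_apply, mul_zero, zero_add]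
    exact Finset.sum_congr rfl fun k _ => by ring
  · intro x y
    have h1 : b x y = c x * c y * (c x * c y * b x y) := by
      linear_combination -b x y * hcc x - c x * c x * b x y * hcc y
    rw [h1, hb, Fintype.sum_option, mul_add, Finset.mul_sum]
    simp only [Option.elim_none, Option.elim_some, smul_dotProduct, dotProduct_smul, smul_eq_mul]
    congr 1
    · ring
    · refine Finset.sum_congr rfl fun k _ => ?_
      linear_combination -(c x * c y * w k * flipSign k x * flipSign k y) * hss k

theorem sg_eq (i : Fin 2) : sg i = 1 ∨ sg i = -1 := by fin_cases i <;> simp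

/-- Moments satisfying all sixteen triangle inequalities come from a probability distribution on
sign vectors. -/
theorem ofMoments_mem_of_triangle_ge {a : Fin 3 → ℝ} {b : Fin 3 → Fin 3 → ℝ}
    (hb1 : ∀ x, b x x = 1) (hbs : ∀ x y, b x y = b y x)
    (hedge : ∀ x y i j, 0 ≤ 1 + sg i * a x + sg j * a y + sg i * sg j * b x y)
    (htri : ∀ c : Fin 3 → ℝ, (∀ x, c x = 1 ∨ c x = -1) →
      0 ≤ 1 + c 0 * c 1 * b 0 1 + c 0 * c 2 * b 0 2 + c 1 * c 2 * b 1 2) :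
    ofMoments a b ∈ CqSync.{u} 3 2 := by
  let g : ℝ → ℝ → ℝ → ℝ := fun p q r =>
    1 + p * a 0 + q * a 1 + r * a 2 + p * q * b 0 1 + p * r * b 0 2 + q * r * b 1 2
  have t₀ := htri ![1, 1, 1] (by intro x; fin_cases x <;> simp)
  have t₁ := htri ![-1, 1, 1] (by intro x; fin_cases x <;> simp)
  have t₂ := htri ![1, -1, 1] (by intro x; fin_cases x <;> simp)
  have t₃ := htri ![1, 1, -1] (by intro x; fin_cases x <;> simp)
  simp at t₀ t₁ t₂ t₃
  have d00 := hedge 0 1 0 0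
  have d01 := hedge 0 1 0 1
  have d10 := hedge 0 1 1 0
  have d11 := hedge 0 1 1 1
  have e00 := hedge 0 2 0 0
  have e01 := hedge 0 2 0 1
  have e10 := hedge 0 2 1 0
  have e11 := hedge 0 2 1 1
  have f00 := hedge 1 2 0 0
  have f01 := hedge 1 2 0 1
  have f10 := hedge 1 2 1 0
  have f11 := hedge 1 2 1 1
  simp only [sg_zero, sg_one] at d00 d01 d10 d11 e00 e01 e10 e11 f00 f01 f10 f11
  -- The parameter t is the free triple moment. Its four lower and four upper bounds give sixteen
  -- compatibility conditions: sign vectors differing in one entry give the twelve edge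
  -- inequalities, antipodal ones the four triangle inequalities.
  obtain ⟨t, l₁, l₂, l₃, l₄, v₁, v₂, v₃, v₄⟩ : ∃ t : ℝ, -t ≤ g 1 1 1 ∧ -t ≤ g 1 (-1) (-1) ∧
      -t ≤ g (-1) 1 (-1) ∧ -t ≤ g (-1) (-1) 1 ∧ t ≤ g (-1) (-1) (-1) ∧ t ≤ g (-1) 1 1 ∧
      t ≤ g 1 (-1) 1 ∧ t ≤ g 1 1 (-1) := by
    refine ⟨min (min (g (-1) (-1) (-1)) (g (-1) 1 1)) (min (g 1 (-1) 1) (g 1 1 (-1))), ?_, ?_, ?_,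
      ?_, (min_le_left _ _).trans (min_le_left _ _), (min_le_left _ _).trans (min_le_right _ _),
      (min_le_right _ _).trans (min_le_left _ _), (min_le_right _ _).trans (min_le_right _ _)⟩
    all_goals
      rw [neg_le]
      refine le_min (le_min ?_ ?_) (le_min ?_ ?_) <;> simp only [g] <;> linarith
  refine ofMoments_mem_of_sum (ι := Fin 2 × Fin 2 × Fin 2)
    (fun k => (g (sg k.1) (sg k.2.1) (sg k.2.2) + sg k.1 * sg k.2.1 * sg k.2.2 * t) / 8)
    (fun k => ![sg k.1, sg k.2.1, sg k.2.2])
    (fun k x y => ![sg k.1, sg k.2.1, sg k.2.2] x * ![sg k.1, sg k.2.1, sg k.2.2] y) ?_ ?_ ?_ ?_ ?_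
  · rintro ⟨i, j, k⟩
    apply div_nonneg _ (by norm_num)
    fin_cases i <;> fin_cases j <;> fin_cases k <;> simp <;> linarith
  · simp [Fintype.sum_prod_type, Fin.sum_univ_two, g]
    ring
  · rintro ⟨i, j, k⟩
    refine ofMoments_sign_mem _ fun x => ?_
    fin_cases x <;> simp [sg_eq]
  · intro x
    fin_cases x <;> simp [Fintype.sum_prod_type, Fin.sum_univ_two, g] <;> ring
  · intro x y
    fin_cases x <;> fin_cases y <;>
      simp [Fintype.sum_prod_type, Fin.sum_univ_two, g, hb1, hbs 1 0, hbs 2 0, hbs 2 1] <;> ring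

theorem IsAdmissible.mem_CqSync {p : Tensor 3 2} (h : IsAdmissible p) : p ∈ CqSync.{u} 3 2 := by
  have hp : p = ofMoments (mean p) (corr p) := by
    ext x y i j; exact h.eq x y i j
  have hb1 : ∀ x, corr p x x = 1 := by
    intro x
    have h1 := h.sum_eq_one x x
    have h2 := h.sync x 0 1 (by simp)
    have h3 := h.sync x 1 0 (by simp)
    simp only [Fin.sum_univ_two, h2, h3] at h1
    simp [corr, Fin.sum_univ_two, h2, h3]
    linarith
  rw [hp]
  by_cases htri : ∀ c : Fin 3 → ℝ, (∀ x, c x = 1 ∨ c x = -1) →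
      0 ≤ 1 + c 0 * c 1 * corr p 0 1 + c 0 * c 2 * corr p 0 2 + c 1 * c 2 * corr p 1 2
  · refine ofMoments_mem_of_triangle_ge hb1 h.symm (fun x y i j => ?_) htri
    have h1 := h.nonneg x y i j
    rw [h.eq] at h1
    linarith
  · push Not at htri
    obtain ⟨c, hc, hlt⟩ := htri
    exact ofMoments_mem_of_triangle_le hb1 h.symm hc hlt.le
      (h.defect_nonneg _ _ _ (hc 0) (hc 1) (hc 2))

/-! ### Closedness of the synchronous quantum set -/

theorem CqSync_subset_CqcSync (n m : ℕ) : CqSync.{u} n m ⊆ CqcSync.{u} n m :=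
  fun _ ⟨⟨hp, A, i, _, h⟩, hs⟩ => ⟨⟨hp, A, i, h⟩, hs⟩

theorem mem_CqSync_iff_isAdmissible {p : Tensor 3 2} : p ∈ CqSync.{u} 3 2 ↔ IsAdmissible p :=
  ⟨fun h => isAdmissible_of_mem_CqcSync (CqSync_subset_CqcSync 3 2 h), fun h => h.mem_CqSync⟩

theorem isClosed_isAdmissible : IsClosed {p | IsAdmissible p} := by
  have hm : ∀ x, Continuous fun p : Tensor 3 2 => mean p x := fun x => by unfold mean; fun_prop
  have hc : ∀ x y, Continuous fun p : Tensor 3 2 => corr p x y := fun x y => by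
    unfold corr; fun_prop
  have h : {p | IsAdmissible p} = {p | p ∈ C 3 2} ∩ {p | IsSynchronous p} ∩
      {p | ∀ x y i j, 0 ≤ p x y i j} ∩ {p | ∀ x y i j,
        p x y i j = (1 + sg i * mean p x + sg j * mean p y + sg i * sg j * corr p x y) / 4} ∩
      {p | ∀ x y, corr p x y = corr p y x} ∩
      {p | ∀ c₁ c₂ c₃ : ℝ, (c₁ = 1 ∨ c₁ = -1) → (c₂ = 1 ∨ c₂ = -1) →
        (c₃ = 1 ∨ c₃ = -1) → ∀ r₁ r₂ r₃ : ℝ, 0 ≤ r₁ → 0 ≤ r₂ → 0 ≤ r₃ →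
        0 ≤ defect r₁ r₂ r₃ (c₁ * mean p 0) (c₂ * mean p 1) (c₃ * mean p 2)
          (c₁ * c₂ * corr p 0 1) (c₁ * c₃ * corr p 0 2) (c₂ * c₃ * corr p 1 2)} := by
    ext p
    exact ⟨fun ⟨h1, h2, h3, h4, h5, h6⟩ => ⟨⟨⟨⟨⟨h1, h2⟩, h3⟩, h4⟩, h5⟩, h6⟩,
      fun ⟨⟨⟨⟨⟨h1, h2⟩, h3⟩, h4⟩, h5⟩, h6⟩ => ⟨h1, h2, h3, h4, h5, h6⟩⟩
  rw [h]
  refine ((((IsClosed.inter ?_ ?_).inter ?_).inter ?_).inter ?_).inter ?_ <;>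
    simp only [C, IsSynchronous, Set.ofPred_forall]
  · exact isClosed_iInter fun x => isClosed_iInter fun y =>
      isClosed_eq (by fun_prop) continuous_const
  · exact isClosed_iInter fun x => isClosed_iInter fun i => isClosed_iInter fun j =>
      isClosed_iInter fun _ => isClosed_eq (by fun_prop) continuous_const
  · exact isClosed_iInter fun x => isClosed_iInter fun y => isClosed_iInter fun i =>
      isClosed_iInter fun j => isClosed_le continuous_const (by fun_prop)
  · exact isClosed_iInter fun x => isClosed_iInter fun y => isClosed_iInter fun i =>
      isClosed_iInter fun j => isClosed_eq (by fun_prop) (by fun_prop)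
  · exact isClosed_iInter fun x => isClosed_iInter fun y => isClosed_eq (hc x y) (hc y x)
  · refine isClosed_iInter fun c₁ => isClosed_iInter fun c₂ => isClosed_iInter fun c₃ =>
      isClosed_iInter fun _ => isClosed_iInter fun _ => isClosed_iInter fun _ =>
      isClosed_iInter fun r₁ => isClosed_iInter fun r₂ => isClosed_iInter fun r₃ =>
      isClosed_iInter fun _ => isClosed_iInter fun _ => isClosed_iInter fun _ =>
      isClosed_le continuous_const ?_
    unfold defect
    fun_prop

/-! ### Closedness of the quantum-commuting set by ultralimits -/

section State

variable {A : Type u} [CStarAlgebra A] {φ : A →ₗ[ℂ] ℂ}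

/-- Nonnegative variance gives |φ(a)|² ≤ φ(a* a), and ‖a‖² − a* a is a hermitian square. The bound
supplies the compactness behind ultralimits of states. -/
theorem IsState.norm_apply_le (h : IsState φ) (a : A) : ‖φ a‖ ≤ ‖a‖ := by
  have h1 : ‖φ a‖ ^ 2 ≤ (φ (star a * a)).re := by
    have := h.re_nonneg (a + (-φ a) • 1)
    simp only [star_add, star_smul, star_one, add_mul, mul_add, smul_mul_assoc, mul_smul_comm,
      mul_one, one_mul, map_add, map_smul, smul_eq_mul, h.map_one, h.map_star] at this
    rw [← Complex.normSq_eq_norm_sq, Complex.normSq_apply]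
    simp at this
    linarith
  have h2 : (φ (star a * a)).re ≤ ‖a‖ ^ 2 := by
    let := CStarAlgebra.spectralOrder A
    have := CStarAlgebra.spectralOrderedRing A
    have h3 : star a * a ≤ algebraMap ℝ A (‖a‖ ^ 2) := CStarAlgebra.star_mul_le_algebraMap_norm_sq
    obtain ⟨b, hb⟩ := CStarAlgebra.nonneg_iff_eq_star_mul_self.1 (sub_nonneg.2 h3)
    have h4 := h.re_nonneg b
    have h5 : φ (algebraMap ℝ A (‖a‖ ^ 2)) = ((‖a‖ ^ 2 : ℝ) : ℂ) := by
      rw [IsScalarTower.algebraMap_apply ℝ ℂ A, Algebra.algebraMap_eq_smul_one, map_smul, h.map_one,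
        smul_eq_mul, mul_one, Complex.coe_algebraMap]
    rw [← hb, map_sub, Complex.sub_re, h5, Complex.ofReal_re] at h4
    linarith
  exact le_of_sq_le_sq (h1.trans h2) (norm_nonneg _)

theorem IsState.nontrivial (h : IsState φ) : Nontrivial A := by
  refine ⟨1, 0, fun h0 => ?_⟩
  have := h.map_one
  rw [h0, map_zero] at this
  exact zero_ne_one this

end State

open scoped ENNReal

noncomputable instance lpCStarAlgebra {ι : Type*} {A : ι → Type*} [∀ i, CStarAlgebra (A i)]
    [∀ i, Nontrivial (A i)] : CStarAlgebra (lp A ∞) where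
  norm_mul_self_le := CStarRing.norm_mul_self_le

open Filter Topology

/-- The bounded sequence formed by a sequence of projections. -/
def lpProj {A : ℕ → Type u} [∀ k, CStarAlgebra (A k)] (P : ∀ k, A k)
    (hP : ∀ k, IsStarProjection (P k)) : lp A ∞ :=
  ⟨P, memℓp_infty ⟨1, by rintro _ ⟨k, rfl⟩; exact (hP k).norm_le⟩⟩

theorem isPVM_lpProj {A : ℕ → Type u} [∀ k, CStarAlgebra (A k)] [∀ k, Nontrivial (A k)] {m : ℕ}
    {P : ∀ k, Fin m → A k} (h : ∀ k, IsPVM (P k)) :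
    IsPVM fun i => lpProj (fun k => P k i) fun k => (h k).proj i := by
  refine ⟨fun i => ⟨?_, ?_⟩, ?_⟩
  · exact Subtype.ext (funext fun k => ((h k).proj i).isIdempotentElem)
  · exact Subtype.ext (funext fun k => ((h k).proj i).isSelfAdjoint)
  · refine Subtype.ext (funext fun k => ?_)
    rw [lp.coeFn_sum, Finset.sum_apply]
    exact (h k).sum_eq_one

/-- The limit of a sequence of states along an ultrafilter. -/
theorem exists_limit_state {A : ℕ → Type u} [∀ k, CStarAlgebra (A k)] [∀ k, Nontrivial (A k)]
    {φ : ∀ k, A k →ₗ[ℂ] ℂ} (hφ : ∀ k, IsState (φ k)) (U : Ultrafilter ℕ) :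
    ∃ ψ : lp A ∞ →ₗ[ℂ] ℂ, IsState ψ ∧
      ∀ a : lp A ∞, Tendsto (fun k => φ k (a k)) U (𝓝 (ψ a)) := by
  have hex : ∀ a : lp A ∞, ∃ z : ℂ, Tendsto (fun k => φ k (a k)) U (𝓝 z) := by
    intro a
    obtain ⟨z, -, hz⟩ := (isCompact_closedBall (0 : ℂ) ‖a‖).ultrafilter_le_nhds
      (U.map fun k => φ k (a k)) (by
        rw [le_principal_iff]
        refine Filter.mem_map.2 (Filter.univ_mem' fun k => ?_)
        rw [Set.mem_preimage, mem_closedBall_zero_iff]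
        exact ((hφ k).norm_apply_le _).trans (lp.norm_apply_le_norm ENNReal.top_ne_zero a k))
    exact ⟨z, hz⟩
  choose L hL using hex
  refine ⟨⟨⟨L, fun a b => ?_⟩, fun c a => ?_⟩, ⟨?_, fun a => ?_⟩, hL⟩
  · refine tendsto_nhds_unique (hL (a + b)) (((hL a).add (hL b)).congr fun k => ?_)
    rw [lp.coeFn_add, Pi.add_apply, map_add]
  · refine tendsto_nhds_unique (hL (c • a)) (((hL a).const_smul c).congr fun k => ?_)
    rw [lp.coeFn_smul, Pi.smul_apply, map_smul]
  · refine tendsto_nhds_unique (hL 1) (tendsto_const_nhds.congr fun k => ?_)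
    exact (hφ k).map_one.symm
  · exact ge_of_tendsto' (hL (star a * a)) fun k => (hφ k).nonneg (a k)

/-- Realisations of the terms of a convergent sequence are placed side by side in the algebra of
bounded sequences; an ultralimit of their states realises the limit. -/
theorem isClosed_Cqc (n m : ℕ) : IsClosed (Cqc.{u} n m) := by
  refine IsSeqClosed.isClosed fun s p hs hlim => ?_
  choose hC A _ E F φ hE hF hEF hφ hp using hs
  have hnt : ∀ k, Nontrivial (A k) := fun k => (hφ k).nontrivial
  have hlim' : ∀ x y i j, Tendsto (fun k => s k x y i j) atTop (𝓝 (p x y i j)) := by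
    intro x y i j
    have h1 := tendsto_pi_nhds.1 hlim x
    have h2 := tendsto_pi_nhds.1 h1 y
    have h3 := tendsto_pi_nhds.1 h2 i
    exact tendsto_pi_nhds.1 h3 j
  obtain ⟨ψ, hψ, hψlim⟩ := exists_limit_state hφ (hyperfilter ℕ)
  refine ⟨fun x y => ?_, lp A ∞, inferInstance, fun x i => lpProj (fun k => E k x i) fun k =>
    (hE k x).proj i, fun y j => lpProj (fun k => F k y j) fun k => (hF k y).proj j, ψ,
    fun x => isPVM_lpProj fun k => hE k x, fun y => isPVM_lpProj fun k => hF k y, ?_, hψ, ?_⟩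
  · refine tendsto_nhds_unique (tendsto_finsetSum _ fun i _ => tendsto_finsetSum _ fun j _ =>
      hlim' x y i j) (tendsto_const_nhds.congr fun k => (hC k x y).symm)
  · exact fun x i y j => Subtype.ext (funext fun k => hEF k x i y j)
  · intro x y i j
    refine tendsto_nhds_unique ?_ (hψlim _)
    have h1 := (Complex.continuous_ofReal.tendsto _).comp
      ((hlim' x y i j).mono_left (Nat.hyperfilter_le_atTop))
    exact h1.congr fun k => hp k x y i j

theorem Cq_subset_Cqc (n m : ℕ) : Cq.{u} n m ⊆ Cqc.{u} n m :=
  fun _ ⟨hp, A, i, _, h⟩ => ⟨hp, A, i, h⟩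

end QCorr

theorem theorem4p8 :
    QCorr.CqSync.{u} 3 2 = QCorr.CqcSync.{u} 3 2 ∧
    IsClosed (QCorr.CqSync.{u} 3 2) ∧
    QCorr.CqaSync.{u} 3 2 = QCorr.CqcSync.{u} 3 2 := by
  have heq : QCorr.CqSync.{u} 3 2 = QCorr.CqcSync.{u} 3 2 :=
    (QCorr.CqSync_subset_CqcSync 3 2).antisymm fun p hp =>
      (QCorr.isAdmissible_of_mem_CqcSync hp).mem_CqSync
  refine ⟨heq, ?_, Set.Subset.antisymm ?_ ?_⟩
  · have h : QCorr.CqSync.{u} 3 2 = {p | QCorr.IsAdmissible p} :=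
      Set.ext fun p => QCorr.mem_CqSync_iff_isAdmissible
    rw [h]
    exact QCorr.isClosed_isAdmissible
  · rintro p ⟨⟨-, hp⟩, hs⟩
    -- The approximating quantum correlations need not be synchronous, so closedness of the
    -- synchronous set alone would not suffice.
    exact ⟨closure_minimal (QCorr.Cq_subset_Cqc 3 2) (QCorr.isClosed_Cqc 3 2) hp, hs⟩
  · rw [← heq]
    rintro p ⟨hp, hs⟩
    exact ⟨⟨hp.1, subset_closure hp⟩, hs⟩
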